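/- Let $q$ and $a$ be coprime natural numbers with $q\ge 1$. Let $S_{q,a}$ be the set of positive integers all of whose prime divisors $p$ satisfy $p\equiv a \pmod q$, let $\bar p_i$ be the $i$-th prime congruent to $a$ modulo $q$, and let $\bar N_k=\prod_{i=1}^k \bar p_i$. Let $\varphi$ be Euler's totient function, $\gamma$ the Euler–Mascheroni constant, and put $\alpha(p;q,a)=\varphi(q)-1$ if $p\equiv a\pmod q$ and $\alpha(p;q,a)=-1$ otherwise. Then the (conditionally convergent) product over all primes in $$C(q,a)^{\varphi(q)} = e^{-\gamma}\,\lim_{x\to\infty}\prod_{p\le x}\Bigl(1-\frac1p\Bigr)^{\alpha(p;q,a)}$$ converges to a positive limit, so that this formula defines a positive real number $C(q,a)$, and $$\limsup_{\substack{n\to\infty\\ n\in S_{q,a}}}\ \frac{n}{\varphi(n)\,\bigl(\log(\varphi(q)\log n)\bigr)^{1/\varphi(q)}}=\frac1{C(q,a)}.$$ Moreover, the $\bar N_k$ lie in $S_{q,a}$, tend to infinity, and attain this limit superior as a limit: $$\lim_{k\to\infty}\frac{\bar N_k}{\varphi(\bar N_k)\,\bigl(\log(\varphi(q)\log \bar N_k)\bigr)^{1/\varphi(q)}}=\frac1{C(q,a)}.$$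 For $q=1$ one has $C(1,a)=e^{-\gamma}$, so this is a generalization of Landau's theorem $\limsup_{n\to\infty} n/(\varphi(n)\log\log n)=e^{\gamma}$. -/

import Mathlib

open Filter Topology

namespace PrimesAP

/-- The set `S_{q,a}` of positive integers all of whose prime divisors are `≡ a (mod q)`. -/
def S (q a : ℕ) : Set ℕ :=
  {n | 0 < n ∧ ∀ p : ℕ, p.Prime → p ∣ n → p ≡ a [MOD q]}

/-- The `i`-th prime in the progression `a (mod q)`, counted from `i = 0`. -/
noncomputable def nthPrime (q a i : ℕ) : ℕ :=
  Nat.nth (fun p => p.Prime ∧ p ≡ a [MOD q]) i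

/-- The `k`-th primorial in `S_{q,a}`: the product of the first `k` primes `≡ a (mod q)`. -/
noncomputable def primorial (q a k : ℕ) : ℕ :=
  ∏ i ∈ Finset.range k, nthPrime q a i

/-- The exponent `α(p; q, a)`: `φ(q) - 1` if `p ≡ a (mod q)`, and `-1` otherwise. -/
def alpha (q a p : ℕ) : ℤ :=
  if p ≡ a [MOD q] then (q.totient : ℤ) - 1 else -1

/-- The partial product `∏_{p ≤ x} (1 - 1/p) ^ α(p; q, a)`, over all primes `p ≤ x`. -/
noncomputable def partialProd (q a x : ℕ) : ℝ :=
  ∏ p ∈ (Finset.Iic x).filter Nat.Prime, (1 - 1 / (p : ℝ)) ^ alpha q a p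

/-- The constant `C(q, a)`, the positive real number with
`C(q, a) ^ φ(q) = e ^ (-γ) * ∏_p (1 - 1/p) ^ α(p; q, a)`. The infinite product converges only
conditionally; its value is the limit of the partial products over `p ≤ x` as `x → ∞`. -/
noncomputable def C (q a : ℕ) : ℝ :=
  (Real.exp (-Real.eulerMascheroniConstant) * limUnder atTop (partialProd q a)) ^
    (1 / (q.totient : ℝ))

/-- The quotient `n / (φ(n) (log (φ(q) log n)) ^ (1 / φ(q)))`. -/
noncomputable def ratio (q n : ℕ) : ℝ :=
  (n : ℝ) / ((n.totient : ℝ) *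
    (Real.log ((q.totient : ℝ) * Real.log (n : ℝ))) ^ (1 / (q.totient : ℝ)))

end PrimesAP

theorem norm_sum_range_smul_le_of_antitone {E : Type*} [NormedAddCommGroup E] [NormedSpace ℝ E]
    {g : ℕ → ℝ} {w : ℕ → E} {B : ℝ} (hg : Antitone g) (hg0 : ∀ n, 0 ≤ g n)
    (hw : ∀ n, ‖∑ i ∈ Finset.range n, w i‖ ≤ B) (n : ℕ) :
    ‖∑ i ∈ Finset.range n, g i • w i‖ ≤ B * g 0 := by
  have hB : 0 ≤ B := (norm_nonneg _).trans (hw 0)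
  rw [Finset.sum_range_by_parts]
  calc _ ≤ ‖g (n - 1) • ∑ i ∈ Finset.range n, w i‖
        + ‖∑ i ∈ Finset.range (n - 1), (g (i + 1) - g i) • ∑ i ∈ Finset.range (i + 1), w i‖ :=
        norm_sub_le _ _
    _ ≤ g (n - 1) * B + ∑ i ∈ Finset.range (n - 1), (g i - g (i + 1)) * B := by
        gcongr
        · rw [norm_smul, Real.norm_of_nonneg (hg0 _)]
          exact mul_le_mul_of_nonneg_left (hw _) (hg0 _)
        · refine norm_sum_le_of_le _ fun i _ => ?_
          rw [norm_smul, Real.norm_eq_abs, abs_sub_comm,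
            abs_of_nonneg (sub_nonneg.2 (hg (Nat.le_succ i)))]
          exact mul_le_mul_of_nonneg_left (hw _) (sub_nonneg.2 (hg (Nat.le_succ i)))
    _ = B * g 0 := by
        rw [← Finset.sum_mul, Finset.sum_range_sub']
        ring

theorem norm_sum_Ico_smul_le_of_antitoneOn {E : Type*} [NormedAddCommGroup E] [NormedSpace ℝ E]
    {f : ℕ → ℝ} {z : ℕ → E} {b : ℝ} {m : ℕ} (hf : AntitoneOn f (Set.Ici m))
    (hf0 : ∀ n, m ≤ n → 0 ≤ f n) (hz : ∀ n, ‖∑ i ∈ Finset.range n, z i‖ ≤ b) (n : ℕ) :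
    ‖∑ i ∈ Finset.Ico m n, f i • z i‖ ≤ 2 * b * f m := by
  rw [Finset.sum_Ico_eq_sum_range]
  refine norm_sum_range_smul_le_of_antitone (g := fun i => f (m + i)) (w := fun i => z (m + i))
    (B := 2 * b) ?_ (fun i => hf0 _ (Nat.le_add_right _ _)) (fun k => ?_) (n - m)
  · intro i j hij
    exact hf (Nat.le_add_right m i) (Nat.le_add_right m j) (by lia)
  · have h := Finset.sum_range_add z m k
    rw [← sub_eq_iff_eq_add'] at h
    rw [← h]
    calc _ ≤ _ := norm_sub_le _ _
      _ ≤ 2 * b := by linarith [hz (m + k), hz m]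

namespace DirichletCharacter

variable {q : ℕ} [NeZero q]

theorem sum_range_level_eq_zero {χ : DirichletCharacter ℂ q} (hχ : χ ≠ 1) :
    ∑ n ∈ Finset.range q, χ (n : ZMod q) = 0 := by
  rw [← χ.sum_eq_zero_of_ne_one hχ]
  refine Finset.sum_bij' (fun n _ => (n : ZMod q)) (fun x _ => x.val) ?_ ?_ ?_ ?_ ?_
  · simp
  · intro x _; simpa using ZMod.val_lt x
  · intro n hn; exact ZMod.val_cast_of_lt (Finset.mem_range.1 hn)
  · intro x _; simp
  · simp

theorem norm_sum_range_le_level {χ : DirichletCharacter ℂ q} (hχ : χ ≠ 1) (N : ℕ) :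
    ‖∑ n ∈ Finset.range N, χ (n : ZMod q)‖ ≤ q := by
  induction N using Nat.strong_induction_on with
  | _ N ih =>
    rcases lt_or_ge N q with h | h
    · calc _ ≤ ∑ n ∈ Finset.range N, (1 : ℝ) :=
            norm_sum_le_of_le _ fun n _ => χ.norm_le_one _
        _ ≤ q := by simpa using h.le
    · obtain ⟨k, rfl⟩ := Nat.exists_eq_add_of_le h
      rw [Finset.sum_range_add, sum_range_level_eq_zero hχ, zero_add]
      simpa using ih k (by have := NeZero.pos q; lia)

theorem norm_LFunction_one_sub_sum_range_le {χ : DirichletCharacter ℂ q} (hχ : χ ≠ 1) {N : ℕ}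
    (hN : 0 < N) :
    ‖LFunction χ 1 - ∑ n ∈ Finset.range N, χ (n : ZMod q) / n‖ ≤ 2 * q / N := by
  have hpart (s : ℝ) (hs : 1 < s) (M : ℕ) (hM : N ≤ M) :
      ‖∑ n ∈ Finset.range M, LSeries.term (fun n => χ n) s n
        - ∑ n ∈ Finset.range N, LSeries.term (fun n => χ n) s n‖ ≤ 2 * q / N := by
    rw [← Finset.sum_Ico_eq_sub _ hM]
    have h1 : ∑ n ∈ Finset.Ico N M, LSeries.term (fun n => χ n) s n
        = ∑ n ∈ Finset.Ico N M, ((n : ℝ) ^ (-s)) • χ (n : ZMod q) := by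
      refine Finset.sum_congr rfl fun n hn => ?_
      have hn0 : n ≠ 0 := by have := (Finset.mem_Ico.1 hn).1; lia
      rw [LSeries.term_of_ne_zero hn0, Complex.real_smul, Complex.ofReal_cpow n.cast_nonneg,
        Complex.ofReal_neg, Complex.cpow_neg, Complex.ofReal_natCast, div_eq_mul_inv, mul_comm]
    rw [h1]
    refine (norm_sum_Ico_smul_le_of_antitoneOn (b := q) (f := fun n : ℕ => (n : ℝ) ^ (-s)) ?_
      (fun n _ => by positivity) (norm_sum_range_le_level hχ) M).trans ?_
    · intro i hi j hj hij
      have : 0 < i := lt_of_lt_of_le hN hi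
      exact Real.rpow_le_rpow_of_nonpos (by exact_mod_cast this) (by exact_mod_cast hij)
        (by linarith)
    · rw [div_eq_mul_inv, ← Real.rpow_neg_one]
      gcongr
      · exact_mod_cast hN
  have hlim (s : ℝ) (hs : 1 < s) :
      ‖LFunction χ s - ∑ n ∈ Finset.range N, LSeries.term (fun n => χ n) s n‖ ≤ 2 * q / N := by
    have hs' : 1 < (s : ℂ).re := by simpa using hs
    have hsum : HasSum (LSeries.term (fun n => χ n) s) (LFunction χ s) := by
      rw [LFunction_eq_LSeries χ hs']
      exact (χ.LSeriesSummable_of_one_lt_re hs').hasSum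
    refine le_of_tendsto (hsum.tendsto_sum_nat.sub_const _).norm ?_
    filter_upwards [eventually_ge_atTop N] with M hM using hpart s hs M hM
  have hcont : Tendsto (fun s : ℝ => LFunction χ s -
      ∑ n ∈ Finset.range N, LSeries.term (fun n => χ n) s n) (𝓝[>] 1)
      (𝓝 (LFunction χ 1 - ∑ n ∈ Finset.range N, χ (n : ZMod q) / n)) := by
    have hof : Tendsto (fun s : ℝ => (s : ℂ)) (𝓝[>] 1) (𝓝 1) := by
      have := Complex.continuous_ofReal.tendsto 1
      rw [Complex.ofReal_one] at this
      exact this.mono_left nhdsWithin_le_nhds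
    refine Tendsto.sub ?_ (tendsto_finsetSum _ fun n _ => ?_)
    · exact ((differentiable_LFunction hχ).continuous.tendsto 1).comp hof
    · rcases eq_or_ne n 0 with rfl | hn
      · simp
      · simp only [LSeries.term_of_ne_zero hn]
        have hn' : (n : ℂ) ≠ 0 := by exact_mod_cast hn
        have h2 : Tendsto (fun s : ℝ => (n : ℂ) ^ (s : ℂ)) (𝓝[>] 1) (𝓝 ((n : ℂ) ^ (1 : ℂ))) :=
          (continuousAt_const_cpow hn').tendsto.comp hof
        rw [Complex.cpow_one] at h2
        exact tendsto_const_nhds.div h2 hn'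
  refine le_of_tendsto hcont.norm ?_
  filter_upwards [self_mem_nhdsWithin] with s hs using hlim s hs

end DirichletCharacter

theorem Finset.sum_range_succ_eq_sum_Ioc {M : Type*} [AddCommMonoid M] {f : ℕ → M} (hf : f 0 = 0)
    (N : ℕ) : ∑ n ∈ Finset.range (N + 1), f n = ∑ n ∈ Finset.Ioc 0 N, f n := by
  rw [Finset.range_eq_Ico, ← Finset.Icc_add_one_left_eq_Ioc,
    ← Finset.sum_erase (a := 0) (Finset.Ico 0 (N + 1)) hf]
  congr 1

namespace ArithmeticFunction

open Finset

theorem sum_vonMangoldt_le (N : ℕ) :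
    ∑ n ∈ Ioc 0 N, Λ n ≤ (Real.log 4 + 4) * N := by
  simpa [Chebyshev.psi] using Chebyshev.psi_le_const_mul_self (x := N) N.cast_nonneg

theorem log_factorial_eq_sum_vonMangoldt (N : ℕ) :
    Real.log N.factorial = ∑ n ∈ Ioc 0 N, Λ n * (N / n : ℕ) := by
  rw [← sum_Ioc_mul_zeta_eq_sum, vonMangoldt_mul_zeta]
  induction N with
  | zero => simp
  | succ k ih =>
    rw [Finset.sum_Ioc_succ_top (Nat.zero_le k), ← ih, Nat.factorial_succ, Nat.cast_mul,
      Real.log_mul (by positivity) (by positivity), log_apply, add_comm]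

theorem abs_sum_vonMangoldt_div_sub_log_le {N : ℕ} (hN : 0 < N) :
    |∑ n ∈ Ioc 0 N, Λ n / n - Real.log N| ≤ Real.log 4 + 4 := by
  have hN' : (0 : ℝ) < N := by exact_mod_cast hN
  have hlog4 : 0 ≤ Real.log 4 := Real.log_nonneg (by norm_num)
  have hupper : Real.log N.factorial ≤ N * ∑ n ∈ Ioc 0 N, Λ n / n := by
    rw [log_factorial_eq_sum_vonMangoldt, mul_sum]
    refine sum_le_sum fun n _ => ?_
    calc Λ n * (N / n : ℕ) ≤ Λ n * ((N : ℝ) / n) :=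
          mul_le_mul_of_nonneg_left Nat.cast_div_le vonMangoldt_nonneg
      _ = N * (Λ n / n) := by ring
  have hlower : N * ∑ n ∈ Ioc 0 N, Λ n / n ≤ Real.log N.factorial + ∑ n ∈ Ioc 0 N, Λ n := by
    rw [log_factorial_eq_sum_vonMangoldt, mul_sum, ← sum_add_distrib]
    refine sum_le_sum fun n hn => ?_
    have hn0 : (0 : ℝ) < n := by exact_mod_cast (mem_Ioc.1 hn).1
    have h1 : (N : ℝ) / n ≤ (N / n : ℕ) + 1 := by
      rw [div_le_iff₀ hn0]
      exact_mod_cast (Nat.lt_div_mul_add (mem_Ioc.1 hn).1 (a := N)).le.trans (by lia)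
    calc N * (Λ n / n) = Λ n * ((N : ℝ) / n) := by ring
      _ ≤ Λ n * ((N / n : ℕ) + 1) := mul_le_mul_of_nonneg_left h1 vonMangoldt_nonneg
      _ = _ := by ring
  have hstir : N * Real.log N - N ≤ Real.log N.factorial := by
    have h1 := Stirling.le_log_factorial_stirling hN.ne'
    have h2 : 0 ≤ Real.log N := Real.log_natCast_nonneg N
    have h3 : 0 ≤ Real.log (2 * Real.pi) := Real.log_nonneg (by linarith [Real.pi_gt_three])
    linarith
  have hfac : Real.log N.factorial ≤ N * Real.log N := by
    rw [← Real.log_pow]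
    exact Real.log_le_log (by positivity) (by exact_mod_cast N.factorial_le_pow)
  have hpsi := sum_vonMangoldt_le N
  rw [abs_le]
  constructor
  · refine le_of_mul_le_mul_left (a := (N : ℝ)) ?_ hN'
    nlinarith
  · refine le_of_mul_le_mul_left (a := (N : ℝ)) ?_ hN'
    nlinarith

end ArithmeticFunction

namespace DirichletCharacter

open ArithmeticFunction Finset

theorem sum_mul_log_div_eq {q : ℕ} (χ : DirichletCharacter ℂ q) (N : ℕ) :
    ∑ n ∈ Ioc 0 N, χ (n : ZMod q) * Real.log n / n
      = ∑ n ∈ Ioc 0 N, χ (n : ZMod q) * (Λ n : ℝ) / n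
          * ∑ m ∈ Ioc 0 (N / n), χ (m : ZMod q) / m := by
  let f : ArithmeticFunction ℂ := ⟨fun n => χ (n : ZMod q) * (Λ n : ℝ) / n, by simp⟩
  let g : ArithmeticFunction ℂ := ⟨fun n => χ (n : ZMod q) / n, by simp⟩
  have h := sum_Ioc_mul_eq_sum_sum f g N
  refine Eq.trans (sum_congr rfl fun n _ => ?_) h
  rw [ArithmeticFunction.mul_apply]
  have hterm : ∀ x ∈ n.divisorsAntidiagonal,
      f x.1 * g x.2 = χ (n : ZMod q) / n * ((Λ x.1 : ℝ) : ℂ) := by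
    intro x hx
    have hx' := (Nat.mem_divisorsAntidiagonal.1 hx).1
    simp only [f, g, ArithmeticFunction.coe_mk]
    rw [← hx']
    push_cast
    rw [map_mul]
    ring
  rw [sum_congr rfl hterm, ← mul_sum, ← Complex.ofReal_sum,
    Nat.sum_divisorsAntidiagonal (n := n) (fun i _ => Λ i), vonMangoldt_sum]
  ring

variable {q : ℕ} [NeZero q]

theorem exists_norm_sum_mul_log_div_le {χ : DirichletCharacter ℂ q} (hχ : χ ≠ 1) :
    ∃ B : ℝ, ∀ N : ℕ, ‖∑ n ∈ Ioc 0 N, χ (n : ZMod q) * Real.log n / n‖ ≤ B := by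
  have hanti : AntitoneOn (fun n : ℕ => Real.log n / n) (Set.Ici 3) := by
    intro i hi j hj hij
    have he : Real.exp 1 ≤ 3 := by linarith [Real.exp_one_lt_d9]
    have hi' : (3 : ℝ) ≤ i := by exact_mod_cast hi
    have hj' : (3 : ℝ) ≤ j := by exact_mod_cast hj
    exact Real.log_div_self_antitoneOn (he.trans hi') (he.trans hj') (by exact_mod_cast hij)
  have htail (N : ℕ) := norm_sum_Ico_smul_le_of_antitoneOn hanti
    (fun n _ => div_nonneg (Real.log_natCast_nonneg n) n.cast_nonneg)
    (norm_sum_range_le_level hχ) (N + 1)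
  refine ⟨‖∑ n ∈ range 3, χ (n : ZMod q) * Real.log n / n‖ + 2 * q * (Real.log 3 / 3)
    + ∑ n ∈ range 3, ‖χ (n : ZMod q) * Real.log n / n‖, fun N => ?_⟩
  have hrange := sum_range_succ_eq_sum_Ioc
    (f := fun n : ℕ => χ (n : ZMod q) * Real.log n / n) (by simp) N
  rw [← hrange]
  have hq : (0 : ℝ) ≤ 2 * q * (Real.log 3 / 3) := by positivity
  rcases le_or_gt 3 (N + 1) with h | h
  · rw [← Finset.sum_range_add_sum_Ico _ h]
    have h1 : ∑ n ∈ Ico 3 (N + 1), χ (n : ZMod q) * Real.log n / n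
        = ∑ n ∈ Ico 3 (N + 1), (Real.log n / n) • χ (n : ZMod q) := by
      refine sum_congr rfl fun n _ => ?_
      rw [Complex.real_smul]
      push_cast
      ring
    rw [h1]
    have h2 := htail N
    rw [Nat.cast_ofNat] at h2
    have h3 := norm_add_le (∑ n ∈ range 3, χ (n : ZMod q) * Real.log n / n)
      (∑ n ∈ Ico 3 (N + 1), (Real.log n / n) • χ (n : ZMod q))
    have h4 : 0 ≤ ∑ n ∈ range 3, ‖χ (n : ZMod q) * Real.log n / n‖ := by positivity
    linarith
  · have h1 : ‖∑ n ∈ range (N + 1), χ (n : ZMod q) * Real.log n / n‖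
        ≤ ∑ n ∈ range 3, ‖χ (n : ZMod q) * Real.log n / n‖ :=
      (norm_sum_le _ _).trans (sum_le_sum_of_subset_of_nonneg
        (range_mono h.le) fun _ _ _ => norm_nonneg _)
    have h2 := norm_nonneg (∑ n ∈ range 3, χ (n : ZMod q) * Real.log n / n)
    linarith

theorem exists_norm_sum_mul_vonMangoldt_div_le {χ : DirichletCharacter ℂ q} (hχ : χ ≠ 1) :
    ∃ B : ℝ, ∀ N : ℕ, ‖∑ n ∈ Ioc 0 N, χ (n : ZMod q) * (Λ n : ℝ) / n‖ ≤ B := by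
  obtain ⟨B, hB⟩ := exists_norm_sum_mul_log_div_le hχ
  have hL : LFunction χ 1 ≠ 0 := LFunction_apply_one_ne_zero hχ
  refine ⟨(B + 2 * q * (Real.log 4 + 4)) / ‖LFunction χ 1‖, fun N => ?_⟩
  rw [le_div_iff₀ (norm_pos_iff.2 hL), ← norm_mul]
  rcases Nat.eq_zero_or_pos N with rfl | hN
  · have := hB 0
    simp at this ⊢
    positivity
  have hN' : (0 : ℝ) < N := by exact_mod_cast hN
  have hdecomp : (∑ n ∈ Ioc 0 N, χ (n : ZMod q) * (Λ n : ℝ) / n) * LFunction χ 1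
      = ∑ n ∈ Ioc 0 N, χ (n : ZMod q) * Real.log n / n
        + ∑ n ∈ Ioc 0 N, χ (n : ZMod q) * (Λ n : ℝ) / n
          * (LFunction χ 1 - ∑ m ∈ Ioc 0 (N / n), χ (m : ZMod q) / m) := by
    rw [sum_mul_log_div_eq, ← sum_add_distrib, sum_mul]
    exact sum_congr rfl fun n _ => by ring
  rw [hdecomp]
  refine (norm_add_le _ _).trans (add_le_add (hB N) ?_)
  have hterm : ∀ n ∈ Ioc 0 N, ‖χ (n : ZMod q) * (Λ n : ℝ) / n
      * (LFunction χ 1 - ∑ m ∈ Ioc 0 (N / n), χ (m : ZMod q) / m)‖ ≤ 2 * q / N * Λ n := by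
    intro n hn
    have hn0 : 0 < n := (mem_Ioc.1 hn).1
    have hn' : (0 : ℝ) < n := by exact_mod_cast hn0
    have h1 := norm_LFunction_one_sub_sum_range_le hχ (N := N / n + 1) (Nat.succ_pos _)
    rw [sum_range_succ_eq_sum_Ioc (by simp)] at h1
    have h2 : ‖χ (n : ZMod q) * (Λ n : ℝ) / n‖ ≤ Λ n / n := by
      rw [norm_div, norm_mul, Complex.norm_real, Real.norm_of_nonneg vonMangoldt_nonneg,
        Complex.norm_natCast]
      have := mul_le_mul_of_nonneg_right (χ.norm_le_one (n : ZMod q))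
        (vonMangoldt_nonneg (n := n))
      rw [one_mul] at this
      gcongr
    have h3 : (N : ℝ) / n ≤ ((N / n + 1 : ℕ) : ℝ) := by
      rw [div_le_iff₀ hn']
      exact_mod_cast (Nat.lt_div_mul_add hn0 (a := N)).le.trans (by lia)
    rw [norm_mul]
    calc _ ≤ Λ n / n * (2 * q / (N / n : ℝ)) := by
          refine mul_le_mul h2 (h1.trans ?_) (norm_nonneg _)
            (div_nonneg vonMangoldt_nonneg hn'.le)
          gcongr
      _ = 2 * q / N * Λ n := by field_simp
  calc _ ≤ ∑ n ∈ Ioc 0 N, 2 * q / N * Λ n := norm_sum_le_of_le _ hterm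
    _ ≤ 2 * q / N * ((Real.log 4 + 4) * N) := by
        rw [← mul_sum]
        exact mul_le_mul_of_nonneg_left (sum_vonMangoldt_le N) (by positivity)
    _ = _ := by field_simp

end DirichletCharacter

namespace ArithmeticFunction

open Finset

theorem summable_vonMangoldt_non_primes_div :
    Summable fun n : ℕ => (if n.Prime then 0 else Λ n) / n := by
  have h := vonMangoldt.summable_residueClass_non_primes_div (q := 1) 0
  refine h.congr fun n => ?_
  simp [vonMangoldt.residueClass, Set.indicator, Subsingleton.elim (n : ZMod 1) 0]

end ArithmeticFunction

namespace DirichletCharacter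

open ArithmeticFunction Finset

variable {q : ℕ} [NeZero q]

theorem exists_norm_sum_one_mul_vonMangoldt_div_sub_log_le :
    ∃ B : ℝ, ∀ N : ℕ, 0 < N →
      ‖∑ n ∈ Ioc 0 N, (1 : DirichletCharacter ℂ q) (n : ZMod q) * (Λ n : ℝ) / n
        - Real.log N‖ ≤ B := by
  refine ⟨∑' n : ℕ, (if n.Prime then 0 else Λ n) / n + ∑ p ∈ q.primeFactors, Λ p / p
    + (Real.log 4 + 4), fun N hN => ?_⟩
  have hnn (n : ℕ) : 0 ≤ Λ n / n := div_nonneg vonMangoldt_nonneg n.cast_nonneg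
  have hnn' (n : ℕ) : 0 ≤ (if n.Prime then 0 else Λ n) / n := by
    split_ifs
    · simp
    · exact hnn n
  have hterm : ∀ n ∈ Ioc 0 N, ‖(1 : DirichletCharacter ℂ q) (n : ZMod q) * (Λ n : ℝ) / n
      - ((Λ n / n : ℝ) : ℂ)‖
      ≤ (if n.Prime then 0 else Λ n) / n + if n ∈ q.primeFactors then Λ n / n else 0 := by
    intro n _
    by_cases hu : IsUnit (n : ZMod q)
    · rw [MulChar.one_apply hu, one_mul, Complex.ofReal_div, Complex.ofReal_natCast, sub_self,
        norm_zero]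
      refine add_nonneg (hnn' n) ?_
      split_ifs
      exacts [hnn n, le_rfl]
    · rw [MulChar.map_nonunit _ hu, zero_mul, zero_div, zero_sub, norm_neg, Complex.norm_real,
        Real.norm_of_nonneg (hnn n)]
      by_cases hp : n.Prime
      · have : n ∈ q.primeFactors := by
          rw [Nat.mem_primeFactors]
          refine ⟨hp, ?_, NeZero.ne q⟩
          rw [ZMod.isUnit_iff_coprime, hp.coprime_iff_not_dvd, not_not] at hu
          exact hu
        simp [hp, this]
      · simp only [hp, if_false]
        refine le_add_of_nonneg_right ?_
        split_ifs
        exacts [hnn n, le_rfl]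
  have hdiff : ‖∑ n ∈ Ioc 0 N, (1 : DirichletCharacter ℂ q) (n : ZMod q) * (Λ n : ℝ) / n
      - ((∑ n ∈ Ioc 0 N, Λ n / n : ℝ) : ℂ)‖
      ≤ ∑' n : ℕ, (if n.Prime then 0 else Λ n) / n + ∑ p ∈ q.primeFactors, Λ p / p := by
    rw [Complex.ofReal_sum, ← sum_sub_distrib]
    refine (norm_sum_le_of_le _ hterm).trans ?_
    rw [sum_add_distrib]
    refine add_le_add (summable_vonMangoldt_non_primes_div.sum_le_tsum _ fun n _ => hnn' n) ?_
    rw [← sum_filter]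
    exact sum_le_sum_of_subset_of_nonneg (fun n hn => (mem_filter.1 hn).2) fun n _ _ => hnn n
  have htot : ‖((∑ n ∈ Ioc 0 N, Λ n / n : ℝ) : ℂ) - Real.log N‖ ≤ Real.log 4 + 4 := by
    rw [← Complex.ofReal_sub, Complex.norm_real]
    exact abs_sum_vonMangoldt_div_sub_log_le hN
  exact (norm_sub_le_norm_sub_add_norm_sub _ _ _).trans (add_le_add hdiff htot)

end DirichletCharacter

namespace ArithmeticFunction

open Finset

variable {q : ℕ} [NeZero q]

theorem exists_abs_sum_residueClass_div_sub_log_le {a : ZMod q} (ha : IsUnit a) :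
    ∃ B : ℝ, ∀ N : ℕ, 0 < N →
      |∑ n ∈ Ioc 0 N, vonMangoldt.residueClass a n / n - Real.log N / q.totient| ≤ B := by
  classical
  have hχ (χ : DirichletCharacter ℂ q) : ∃ B : ℝ, ∀ N : ℕ, 0 < N →
      ‖∑ n ∈ Ioc 0 N, χ (n : ZMod q) * (Λ n : ℝ) / n
        - if χ = 1 then ((Real.log N : ℝ) : ℂ) else 0‖ ≤ B := by
    by_cases h : χ = 1
    · subst h
      simpa only [if_true] using
        DirichletCharacter.exists_norm_sum_one_mul_vonMangoldt_div_sub_log_le (q := q)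
    · obtain ⟨B, hB⟩ := DirichletCharacter.exists_norm_sum_mul_vonMangoldt_div_le h
      exact ⟨B, fun N _ => by simpa [h] using hB N⟩
  choose B hB using hχ
  refine ⟨(q.totient : ℝ)⁻¹ * ∑ χ, B χ, fun N hN => ?_⟩
  have hid : ((∑ n ∈ Ioc 0 N, vonMangoldt.residueClass a n / n - Real.log N / q.totient : ℝ) : ℂ)
      = (q.totient : ℂ)⁻¹ * ∑ χ : DirichletCharacter ℂ q, χ a⁻¹ *
        (∑ n ∈ Ioc 0 N, χ (n : ZMod q) * (Λ n : ℝ) / n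
          - if χ = 1 then ((Real.log N : ℝ) : ℂ) else 0) := by
    simp only [mul_sub, sum_sub_distrib, mul_ite, mul_zero, sum_ite_eq', mem_univ, if_true]
    have ha' : IsUnit a⁻¹ :=
      ⟨⟨a⁻¹, a, ZMod.inv_mul_of_unit a ha, ZMod.mul_inv_of_unit a ha⟩, rfl⟩
    rw [MulChar.one_apply ha', one_mul, Complex.ofReal_sub, Complex.ofReal_div,
      Complex.ofReal_natCast, Complex.ofReal_sum]
    congr 1
    · simp only [mul_sum]
      rw [sum_comm]
      refine sum_congr rfl fun n _ => ?_
      rw [Complex.ofReal_div, vonMangoldt.residueClass_apply ha, Complex.ofReal_natCast, mul_sum,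
        sum_div]
      exact sum_congr rfl fun χ _ => by ring
    · ring
  rw [← Real.norm_eq_abs, ← Complex.norm_real, hid, norm_mul, norm_inv, Complex.norm_natCast]
  refine mul_le_mul_of_nonneg_left (norm_sum_le_of_le _ fun χ _ => ?_) (by positivity)
  rw [norm_mul]
  calc _ ≤ 1 * _ := mul_le_mul_of_nonneg_right (χ.norm_le_one _) (norm_nonneg _)
    _ ≤ B χ := by rw [one_mul]; exact hB χ N hN

end ArithmeticFunction

/-- **Mertens' first theorem** in arithmetic progressions. -/
theorem Nat.exists_abs_sum_log_prime_modEq_div_sub_log_le {q a : ℕ} (hq : 0 < q)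
    (hqa : q.Coprime a) :
    ∃ B : ℝ, ∀ N : ℕ,
      |∑ p ∈ Finset.range N with p.Prime ∧ p ≡ a [MOD q], Real.log p / p
        - Real.log N / q.totient| ≤ B := by
  have : NeZero q := ⟨hq.ne'⟩
  have ha : IsUnit (a : ZMod q) := (ZMod.isUnit_iff_coprime a q).2 hqa.symm
  have hφ : (1 : ℝ) ≤ q.totient := by exact_mod_cast Nat.totient_pos.2 hq
  obtain ⟨B, hB⟩ := ArithmeticFunction.exists_abs_sum_residueClass_div_sub_log_le ha
  have hsum := ArithmeticFunction.vonMangoldt.summable_residueClass_non_primes_div (a : ZMod q)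
  have hnn (n : ℕ) : 0 ≤ (if n.Prime then 0
      else ArithmeticFunction.vonMangoldt.residueClass (a : ZMod q) n) / n := by
    split_ifs
    · simp
    · exact div_nonneg (ArithmeticFunction.vonMangoldt.residueClass_nonneg _ _) n.cast_nonneg
  set T := ∑' n : ℕ, (if n.Prime then 0
      else ArithmeticFunction.vonMangoldt.residueClass (a : ZMod q) n) / n with hT
  have hT0 : 0 ≤ T := tsum_nonneg hnn
  have hB0 : 0 ≤ B := (abs_nonneg _).trans (hB 1 one_pos)
  refine ⟨B + T + Real.log 2, fun N => ?_⟩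
  have hlog2 : 0 ≤ Real.log 2 := Real.log_nonneg (by norm_num)
  rcases lt_or_ge N 2 with h | h
  · have : N = 0 ∨ N = 1 := by lia
    rcases this with rfl | rfl
    · simp; positivity
    · simp [Finset.filter_singleton, Nat.not_prime_zero]; positivity
  obtain ⟨M, rfl⟩ : ∃ M, N = M + 1 := ⟨N - 1, by lia⟩
  have hM : 0 < M := by lia
  have hM' : (0 : ℝ) < M := by exact_mod_cast hM
  have hsplit : ∑ n ∈ Finset.Ioc 0 M,
        ArithmeticFunction.vonMangoldt.residueClass (a : ZMod q) n / n
      = ∑ p ∈ Finset.range (M + 1) with p.Prime ∧ p ≡ a [MOD q], Real.log p / p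
        + ∑ n ∈ Finset.range (M + 1), (if n.Prime then 0
          else ArithmeticFunction.vonMangoldt.residueClass (a : ZMod q) n) / n := by
    rw [← Finset.sum_range_succ_eq_sum_Ioc (by simp), Finset.sum_filter,
      ← Finset.sum_add_distrib]
    refine Finset.sum_congr rfl fun n _ => ?_
    by_cases hp : n.Prime
    · by_cases hm : n ≡ a [MOD q]
      · have hm' : (n : ZMod q) = a := (ZMod.natCast_eq_natCast_iff _ _ _).2 hm
        simp [hp, hm, hm', ArithmeticFunction.vonMangoldt.residueClass, Set.indicator,
          ArithmeticFunction.vonMangoldt_apply_prime hp]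
      · have hm' : (n : ZMod q) ≠ a := fun h => hm ((ZMod.natCast_eq_natCast_iff _ _ _).1 h)
        simp [hp, hm, hm', ArithmeticFunction.vonMangoldt.residueClass, Set.indicator]
    · simp [hp]
  have h1 := hB M hM
  rw [hsplit] at h1
  have h2 : ∑ n ∈ Finset.range (M + 1), (if n.Prime then 0
          else ArithmeticFunction.vonMangoldt.residueClass (a : ZMod q) n) / n ≤ T :=
    hsum.sum_le_tsum _ fun n _ => hnn n
  have h3 : 0 ≤ ∑ n ∈ Finset.range (M + 1), (if n.Prime then 0
          else ArithmeticFunction.vonMangoldt.residueClass (a : ZMod q) n) / n :=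
    Finset.sum_nonneg fun n _ => hnn n
  have h4 : Real.log M / q.totient ≤ Real.log (M + 1 : ℕ) / q.totient := by
    gcongr
    lia
  have h5 : Real.log (M + 1 : ℕ) / q.totient ≤ Real.log M / q.totient + Real.log 2 := by
    have : Real.log (M + 1 : ℕ) ≤ Real.log M + Real.log 2 := by
      rw [← Real.log_mul hM'.ne' (by norm_num)]
      refine Real.log_le_log (by positivity) ?_
      have : (1 : ℝ) ≤ M := by exact_mod_cast hM
      push_cast
      linarith
    calc _ ≤ (Real.log M + Real.log 2) / q.totient := by gcongr
      _ = Real.log M / q.totient + Real.log 2 / q.totient := by ring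
      _ ≤ _ := by gcongr; exact _root_.div_le_self hlog2 hφ
  rw [abs_le] at h1 ⊢
  constructor <;> linarith [h1.1, h1.2]

theorem exists_tendsto_sum_range_div_log {z : ℕ → ℝ} {B : ℝ}
    (hz : ∀ N, |∑ i ∈ Finset.range N, z i| ≤ B) :
    ∃ l, Tendsto (fun N => ∑ i ∈ Finset.range N, z i / Real.log ((i : ℝ) + 2)) atTop (𝓝 l) := by
  have hanti : Antitone fun i : ℕ => (Real.log ((i : ℝ) + 2))⁻¹ := by
    intro i j hij
    have : 0 < Real.log ((i : ℝ) + 2) := Real.log_pos (by linarith [i.cast_nonneg (α := ℝ)])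
    simp only
    gcongr
  have hlim : Tendsto (fun i : ℕ => (Real.log ((i : ℝ) + 2))⁻¹) atTop (𝓝 0) :=
    (Real.tendsto_log_atTop.comp
      (tendsto_natCast_atTop_atTop.atTop_add tendsto_const_nhds)).inv_tendsto_atTop
  obtain ⟨l, hl⟩ := cauchySeq_tendsto_of_complete
    (hanti.cauchySeq_series_mul_of_tendsto_zero_of_bounded (z := z) (b := B) hlim hz)
  refine ⟨l, hl.congr fun N => Finset.sum_congr rfl fun i _ => ?_⟩
  rw [smul_eq_mul, div_eq_mul_inv, mul_comm]

theorem Nat.sum_range_add_two_filter_prime {M : Type*} [AddCommMonoid M] (f : ℕ → M) (N : ℕ) :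
    ∑ p ∈ Finset.range (N + 2) with p.Prime, f p
      = ∑ i ∈ Finset.range N, if (i + 2).Prime then f (i + 2) else 0 := by
  rw [Finset.sum_filter, Finset.sum_range_succ', Finset.sum_range_succ']
  simp [Nat.not_prime_zero, Nat.not_prime_one]

theorem Nat.sum_range_add_two_log_prime_div (w : ℕ → ℝ) (N : ℕ) :
    ∑ p ∈ Finset.range (N + 2) with p.Prime, w p / p
      = ∑ i ∈ Finset.range N, (if (i + 2).Prime then
          w (i + 2) * (Real.log (i + 2 : ℕ) / (i + 2 : ℕ)) else 0) / Real.log ((i : ℝ) + 2) := by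
  rw [Nat.sum_range_add_two_filter_prime]
  refine Finset.sum_congr rfl fun i _ => ?_
  have : Real.log ((i : ℝ) + 2) ≠ 0 := (Real.log_pos (by linarith [i.cast_nonneg (α := ℝ)])).ne'
  split_ifs
  · push_cast
    field_simp
  · simp

theorem Real.abs_log_one_sub_add_self_le {x : ℝ} (hx0 : 0 ≤ x) (hx : x ≤ 1 / 2) :
    |Real.log (1 - x) + x| ≤ 2 * x ^ 2 := by
  have h := Real.abs_log_sub_add_sum_range_le (x := x) (by rw [abs_of_nonneg hx0]; linarith) 1
  rw [abs_of_nonneg hx0] at h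
  simp at h
  rw [add_comm]
  refine h.trans ?_
  rw [div_le_iff₀ (by linarith)]
  nlinarith [sq_nonneg x]

theorem Nat.Prime.one_div_le_half {p : ℕ} (hp : p.Prime) : 1 / (p : ℝ) ≤ 1 / 2 := by
  have : (2 : ℝ) ≤ p := by exact_mod_cast hp.two_le
  exact one_div_le_one_div_of_le (by norm_num) this

theorem Nat.Prime.one_sub_one_div_pos {p : ℕ} (hp : p.Prime) : 0 < 1 - 1 / (p : ℝ) := by
  linarith [hp.one_div_le_half]

/-- The first Mertens theorem over all primes. -/
theorem Nat.exists_abs_sum_log_prime_div_sub_log_le :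
    ∃ B : ℝ, ∀ N : ℕ,
      |∑ p ∈ Finset.range N with p.Prime, Real.log p / p - Real.log N| ≤ B := by
  simpa [Nat.modEq_one] using
    Nat.exists_abs_sum_log_prime_modEq_div_sub_log_le one_pos (Nat.coprime_one_left 0)

theorem Nat.summable_ite_prime_mul_log_one_sub_add {w : ℕ → ℝ} {K : ℝ} (hw : ∀ p, |w p| ≤ K) :
    Summable fun p : ℕ =>
      if p.Prime then w p * (Real.log (1 - 1 / (p : ℝ)) + 1 / p) else 0 := by
  have hK : 0 ≤ K := (abs_nonneg _).trans (hw 0)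
  refine Summable.of_norm_bounded (g := fun p : ℕ => 2 * K * (1 / (p : ℝ) ^ 2))
    ((Real.summable_one_div_nat_pow.2 one_lt_two).mul_left _) fun p => ?_
  split_ifs with hp
  · rw [Real.norm_eq_abs, abs_mul]
    calc _ ≤ K * (2 * (1 / (p : ℝ)) ^ 2) :=
          mul_le_mul (hw p) (Real.abs_log_one_sub_add_self_le (by positivity) hp.one_div_le_half)
            (abs_nonneg _) hK
      _ = _ := by ring
  · rw [norm_zero]
    positivity

namespace PrimesAP

theorem abs_alpha_le (q a p : ℕ) : |(alpha q a p : ℝ)| ≤ q.totient + 1 := by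
  unfold alpha
  have : (0 : ℝ) ≤ q.totient := Nat.cast_nonneg _
  split_ifs
  · push_cast
    rw [abs_le]
    constructor <;> linarith
  · push_cast
    rw [abs_neg, abs_one]
    linarith

theorem sum_alpha_mul (q a : ℕ) (s : Finset ℕ) (f : ℕ → ℝ) :
    ∑ p ∈ s with p.Prime, (alpha q a p : ℝ) * f p
      = q.totient * ∑ p ∈ s with p.Prime ∧ p ≡ a [MOD q], f p - ∑ p ∈ s with p.Prime, f p := by
  rw [← Finset.filter_filter, Finset.sum_filter (p := fun p => p ≡ a [MOD q]), Finset.mul_sum,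
    ← Finset.sum_sub_distrib]
  refine Finset.sum_congr rfl fun p _ => ?_
  unfold alpha
  split_ifs <;> push_cast <;> ring

theorem exists_tendsto_sum_alpha_div {q a : ℕ} (hq : 0 < q) (hqa : q.Coprime a) :
    ∃ l, Tendsto (fun N => ∑ p ∈ Finset.range N with p.Prime, (alpha q a p : ℝ) / p)
      atTop (𝓝 l) := by
  obtain ⟨B₁, hB₁⟩ := Nat.exists_abs_sum_log_prime_modEq_div_sub_log_le hq hqa
  obtain ⟨B₂, hB₂⟩ := Nat.exists_abs_sum_log_prime_div_sub_log_le
  have hφ : (0 : ℝ) < q.totient := by exact_mod_cast Nat.totient_pos.2 hq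
  have hbound (N : ℕ) : |∑ i ∈ Finset.range N, if (i + 2).Prime then
      (alpha q a (i + 2) : ℝ) * (Real.log (i + 2 : ℕ) / (i + 2 : ℕ)) else 0|
      ≤ q.totient * B₁ + B₂ := by
    rw [← Nat.sum_range_add_two_filter_prime
      (fun p => (alpha q a p : ℝ) * (Real.log p / p)), sum_alpha_mul]
    have h1 := abs_le.1 (hB₁ (N + 2))
    have h2 := abs_le.1 (hB₂ (N + 2))
    have h3 : (q.totient : ℝ) * (Real.log (N + 2 : ℕ) / q.totient) = Real.log (N + 2 : ℕ) := by
      field_simp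
    rw [abs_le]
    constructor
    · nlinarith [mul_le_mul_of_nonneg_left h1.1 hφ.le]
    · nlinarith [mul_le_mul_of_nonneg_left h1.2 hφ.le]
  obtain ⟨l, hl⟩ := exists_tendsto_sum_range_div_log hbound
  refine ⟨l, (tendsto_add_atTop_iff_nat 2).1 (hl.congr fun N => ?_)⟩
  exact (Nat.sum_range_add_two_log_prime_div (fun p => (alpha q a p : ℝ)) N).symm

theorem exists_tendsto_sum_alpha_mul_log {q a : ℕ} (hq : 0 < q) (hqa : q.Coprime a) :
    ∃ l, Tendsto (fun N => ∑ p ∈ Finset.range N with p.Prime,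
      (alpha q a p : ℝ) * Real.log (1 - 1 / (p : ℝ))) atTop (𝓝 l) := by
  obtain ⟨l, hl⟩ := exists_tendsto_sum_alpha_div hq hqa
  have hs := (Nat.summable_ite_prime_mul_log_one_sub_add
    (abs_alpha_le q a)).hasSum.tendsto_sum_nat
  refine ⟨_, (hs.sub hl).congr fun N => ?_⟩
  rw [← Finset.sum_filter, ← Finset.sum_sub_distrib]
  exact Finset.sum_congr rfl fun p _ => by ring

theorem partialProd_eq_exp (q a x : ℕ) :
    partialProd q a x = Real.exp (∑ p ∈ Finset.range (x + 1) with p.Prime,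
      (alpha q a p : ℝ) * Real.log (1 - 1 / (p : ℝ))) := by
  have hIic : Finset.Iic x = Finset.range (x + 1) := by
    ext
    simp
  rw [partialProd, hIic, Real.exp_sum]
  refine Finset.prod_congr rfl fun p hp => ?_
  have hpos := (Finset.mem_filter.1 hp).2.one_sub_one_div_pos
  rw [mul_comm, Real.exp_mul, Real.exp_log hpos, Real.rpow_intCast]

end PrimesAP

theorem Nat.exists_tendsto_sum_one_div_prime_sub_log_log :
    ∃ M : ℝ, Tendsto (fun N : ℕ => ∑ p ∈ Finset.range N with p.Prime, 1 / (p : ℝ)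
      - Real.log (Real.log N)) atTop (𝓝 M) := by
  obtain ⟨B, hB⟩ := Nat.exists_abs_sum_log_prime_div_sub_log_le
  let L : ℕ → ℝ := fun i => Real.log ((i : ℝ) + 2)
  have hL0 (i : ℕ) : 0 < L i := Real.log_pos (by linarith [i.cast_nonneg (α := ℝ)])
  have hLle (i : ℕ) : L i ≤ L (i + 1) := by
    refine Real.log_le_log (by positivity) ?_
    push_cast
    linarith
  have hLsub (i : ℕ) : L (i + 1) - L i ≤ 1 := by
    have hi : (0 : ℝ) ≤ i := i.cast_nonneg
    have h := Real.log_le_sub_one_of_pos (x := ((i + 1 : ℕ) + 2 : ℝ) / ((i : ℝ) + 2))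
      (by positivity)
    rw [Real.log_div (by positivity) (by positivity)] at h
    refine h.trans ?_
    rw [sub_le_iff_le_add, div_le_iff₀ (by positivity)]
    push_cast
    linarith
  let z : ℕ → ℝ := fun i =>
    (if (i + 2).Prime then 1 * (Real.log (i + 2 : ℕ) / (i + 2 : ℕ)) else 0) - (L (i + 1) - L i)
  have hz (N : ℕ) : |∑ i ∈ Finset.range N, z i| ≤ B + L 0 := by
    simp only [z]
    rw [Finset.sum_sub_distrib, ← Nat.sum_range_add_two_filter_prime
      (fun p => 1 * (Real.log p / p)), Finset.sum_range_sub]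
    have h1 := abs_le.1 (hB (N + 2))
    have h2 : Real.log (N + 2 : ℕ) = L N := by simp [L]
    simp only [one_mul]
    rw [h2] at h1
    have := hL0 0
    rw [abs_le]
    constructor <;> linarith [h1.1, h1.2]
  obtain ⟨l, hl⟩ := exists_tendsto_sum_range_div_log hz
  let e : ℕ → ℝ := fun i => (L (i + 1) - L i) / L i - (Real.log (L (i + 1)) - Real.log (L i))
  have he0 (i : ℕ) : 0 ≤ e i := by
    have h := Real.log_le_sub_one_of_pos (x := L (i + 1) / L i) (_root_.div_pos (hL0 _) (hL0 _))
    rw [Real.log_div (hL0 _).ne' (hL0 _).ne'] at h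
    have : (L (i + 1) - L i) / L i = L (i + 1) / L i - 1 := by
      rw [sub_div, div_self (hL0 i).ne']
    simp only [e]
    linarith
  have he1 (i : ℕ) : e i ≤ 1 / L i - 1 / L (i + 1) := by
    have h := Real.one_sub_inv_le_log_of_pos (x := L (i + 1) / L i) (_root_.div_pos (hL0 _) (hL0 _))
    rw [Real.log_div (hL0 _).ne' (hL0 _).ne', inv_div] at h
    have h1 : (L (i + 1) - L i) / L i - (1 - L i / L (i + 1))
        = (L (i + 1) - L i) * (1 / L i - 1 / L (i + 1)) := by
      have := (hL0 i).ne'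
      have := (hL0 (i + 1)).ne'
      field_simp
    have h2 : 0 ≤ 1 / L i - 1 / L (i + 1) :=
      sub_nonneg.2 (one_div_le_one_div_of_le (hL0 i) (hLle i))
    have h3 := mul_le_mul_of_nonneg_right (hLsub i) h2
    simp only [e]
    linarith
  have hes : Summable e := by
    refine summable_of_sum_range_le (c := 1 / L 0) he0 fun N => ?_
    refine (Finset.sum_le_sum fun i _ => he1 i).trans ?_
    rw [Finset.sum_range_sub']
    have := one_div_pos.2 (hL0 N)
    linarith
  refine ⟨l + ∑' i, e i - Real.log (L 0), (tendsto_add_atTop_iff_nat 2).1 ?_⟩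
  refine ((hl.add hes.hasSum.tendsto_sum_nat).sub_const _).congr fun N => ?_
  have h1 : ∑ i ∈ Finset.range N, z i / Real.log ((i : ℝ) + 2)
      = ∑ p ∈ Finset.range (N + 2) with p.Prime, 1 / (p : ℝ)
        - ∑ i ∈ Finset.range N, (L (i + 1) - L i) / L i := by
    rw [Nat.sum_range_add_two_log_prime_div (fun _ => 1), ← Finset.sum_sub_distrib]
    exact Finset.sum_congr rfl fun i _ => sub_div _ _ _
  have h2 : ∑ i ∈ Finset.range N, e i = ∑ i ∈ Finset.range N, (L (i + 1) - L i) / L i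
      - (Real.log (L N) - Real.log (L 0)) := by
    simp only [e]
    rw [Finset.sum_sub_distrib, Finset.sum_range_sub (fun i => Real.log (L i))]
  have h3 : Real.log (N + 2 : ℕ) = L N := by simp [L]
  rw [h1, h2, h3]
  ring

/-- The prime zeta function and the Riemann zeta function agree to the right of `1` up to a
function that is continuous at `1`. -/
theorem Nat.tendsto_tsum_prime_rpow_add_log :
    Tendsto (fun s : ℝ => ∑' p : ℕ, (if p.Prime then (p : ℝ) ^ (-s) else 0) + Real.log (s - 1))
      (𝓝[>] 1)
      (𝓝 (∑' p : ℕ, if p.Prime then Real.log (1 - 1 / (p : ℝ)) + 1 / p else 0)) := by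
  let R : ℝ → ℕ → ℝ := fun s p =>
    if p.Prime then Real.log (1 - (p : ℝ) ^ (-s)) + (p : ℝ) ^ (-s) else 0
  have hpow {s : ℝ} (hs : 1 ≤ s) {p : ℕ} (hp : p.Prime) : (p : ℝ) ^ (-s) ≤ 1 / p := by
    rw [one_div, ← Real.rpow_neg_one]
    exact Real.rpow_le_rpow_of_exponent_le (by exact_mod_cast hp.one_le) (by linarith)
  have hRle {s : ℝ} (hs : 1 ≤ s) (p : ℕ) : ‖R s p‖ ≤ 2 * (1 / (p : ℝ) ^ 2) := by
    simp only [R]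
    split_ifs with hp
    · have h0 : 0 ≤ (p : ℝ) ^ (-s) := by positivity
      refine (Real.abs_log_one_sub_add_self_le h0 ((hpow hs hp).trans hp.one_div_le_half)).trans ?_
      have := pow_le_pow_left₀ h0 (hpow hs hp) 2
      rw [one_div, inv_pow, ← one_div] at this
      linarith
    · rw [norm_zero]
      positivity
  have hg : Summable fun p : ℕ => 2 * (1 / (p : ℝ) ^ 2) :=
    (Real.summable_one_div_nat_pow.2 one_lt_two).mul_left _
  have hRlim : Tendsto (fun s => ∑' p, R s p) (𝓝[>] 1) (𝓝 (∑' p, R 1 p)) := by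
    refine tendsto_tsum_of_dominated_convergence hg (fun p => ?_) ?_
    · simp only [R]
      split_ifs with hp
      · have hp0 : (0 : ℝ) < p := by exact_mod_cast hp.pos
        have hc : Tendsto (fun s : ℝ => (p : ℝ) ^ (-s)) (𝓝[>] 1) (𝓝 ((p : ℝ) ^ (-1 : ℝ))) :=
          ((continuous_const.rpow continuous_neg fun _ => Or.inl hp0.ne').tendsto 1).mono_left
            nhdsWithin_le_nhds
        have hne : 1 - (p : ℝ) ^ (-1 : ℝ) ≠ 0 := by
          rw [Real.rpow_neg_one, ← one_div]
          exact hp.one_sub_one_div_pos.ne'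
        exact ((hc.const_sub 1).log hne).add hc
      · exact tendsto_const_nhds
    · filter_upwards [self_mem_nhdsWithin] with s hs p using hRle (le_of_lt hs) p
  have hR1 : ∑' p, R 1 p = ∑' p : ℕ, if p.Prime then Real.log (1 - 1 / (p : ℝ)) + 1 / p else 0 := by
    refine tsum_congr fun p => ?_
    simp only [R, Real.rpow_neg_one, one_div]
  rw [← hR1]
  have hzeta : Tendsto (fun s : ℝ => Real.log ((s - 1) * ∑' n : ℕ, 1 / (n : ℝ) ^ s)) (𝓝[>] 1)
      (𝓝 0) := by
    have := tendsto_sub_mul_tsum_nat_rpow.log one_ne_zero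
    rwa [Real.log_one] at this
  have hkey (s : ℝ) (hs : 1 < s) : ∑' p : ℕ, (if p.Prime then (p : ℝ) ^ (-s) else 0)
      = ∑' p, R s p + Real.log (∑' n : ℕ, 1 / (n : ℝ) ^ s) := by
    have hsum : Summable fun n : ℕ => (n : ℝ) ^ (-s) := Real.summable_nat_rpow.2 (by linarith)
    have hsump : Summable fun p : ℕ => if p.Prime then (p : ℝ) ^ (-s) else 0 :=
      Summable.of_nonneg_of_le (fun p => by positivity)
        (fun p => by split_ifs <;> [exact le_rfl; positivity]) hsum
    let f : ℕ →*₀ ℝ :=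
      { toFun := fun n => (n : ℝ) ^ (-s)
        map_zero' := by
          rw [Nat.cast_zero, Real.zero_rpow (by linarith)]
        map_one' := by simp
        map_mul' := fun m n => by
          rw [Nat.cast_mul, Real.mul_rpow m.cast_nonneg n.cast_nonneg] }
    have hf (n : ℕ) : f n = (n : ℝ) ^ (-s) := rfl
    have heuler := EulerProduct.eulerProduct_completely_multiplicative (f := f) hsum.norm
    have hZ : ∑' n, f n = ∑' n : ℕ, 1 / (n : ℝ) ^ s := by
      refine tsum_congr fun n => ?_
      rw [hf, Real.rpow_neg n.cast_nonneg, one_div]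
    have hZpos : 0 < ∑' n, f n := by
      refine hsum.tsum_pos (fun n => by positivity) 1 ?_
      simp
    have hlog := heuler.log hZpos.ne'
    have h1 := hsump.hasSum.tendsto_sum_nat.sub
      (Summable.of_norm_bounded hg (hRle hs.le)).hasSum.tendsto_sum_nat
    have h2 : Tendsto (fun N : ℕ => ∑ p ∈ Finset.range N, (if p.Prime then (p : ℝ) ^ (-s) else 0)
        - ∑ p ∈ Finset.range N, R s p) atTop (𝓝 (Real.log (∑' n, f n))) := by
      refine hlog.congr fun N => ?_
      have hpos {p : ℕ} (hp : p.Prime) : 0 < 1 - f p := by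
        have := hpow hs.le hp
        have := hp.one_div_le_half
        rw [hf]
        linarith
      rw [Real.log_prod fun p hp => (inv_pos.2 (hpos (Nat.prime_of_mem_primesBelow hp))).ne',
        Nat.primesBelow, Finset.sum_filter, ← Finset.sum_sub_distrib]
      refine Finset.sum_congr rfl fun p _ => ?_
      simp only [R]
      split_ifs with hp
      · rw [Real.log_inv, hf]
        ring
      · simp
    have := tendsto_nhds_unique h1 h2
    rw [hZ] at this
    linarith
  have hfin := hRlim.add hzeta
  rw [add_zero] at hfin
  refine hfin.congr' ?_
  filter_upwards [self_mem_nhdsWithin] with s hs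
  have hs' : 0 < s - 1 := sub_pos.2 hs
  have hsum : Summable fun n : ℕ => 1 / (n : ℝ) ^ s := Real.summable_one_div_nat_rpow.2 hs
  have hZpos : 0 < ∑' n : ℕ, 1 / (n : ℝ) ^ s :=
    hsum.tsum_pos (fun n => by positivity) 1 (by simp)
  rw [hkey s hs, Real.log_mul hs'.ne' hZpos.ne']
  ring

theorem Real.tendsto_log_log_natCeil_exp_sub_log :
    Tendsto (fun k : ℕ => Real.log (Real.log ⌈Real.exp k⌉₊) - Real.log k) atTop (𝓝 0) := by
  have hupper : Tendsto (fun k : ℕ => 1 / (k : ℝ)) atTop (𝓝 0) :=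
    tendsto_one_div_atTop_nhds_zero_nat
  refine tendsto_of_tendsto_of_tendsto_of_le_of_le' tendsto_const_nhds hupper ?_ ?_
  all_goals
    filter_upwards [eventually_gt_atTop 0] with k hk
    have hk' : (0 : ℝ) < k := by exact_mod_cast hk
    have hle : (k : ℝ) ≤ Real.log ⌈Real.exp k⌉₊ := by
      rw [Real.le_log_iff_exp_le (by exact_mod_cast Nat.ceil_pos.2 (Real.exp_pos _))]
      exact Nat.le_ceil _
  · exact sub_nonneg.2 (Real.log_le_log hk' hle)
  · have hge : Real.log ⌈Real.exp k⌉₊ ≤ k + 1 := by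
      rw [Real.log_le_iff_le_exp (by exact_mod_cast Nat.ceil_pos.2 (Real.exp_pos _)),
        Real.exp_add]
      have h1 : 1 ≤ Real.exp k := Real.one_le_exp hk'.le
      have h2 : 2 ≤ Real.exp 1 := by linarith [Real.exp_one_gt_d9]
      have h3 := (Nat.ceil_lt_add_one (Real.exp_pos (k : ℝ)).le).le
      nlinarith
    have hlog : 0 < Real.log ⌈Real.exp k⌉₊ := hk'.trans_le hle
    rw [← Real.log_div hlog.ne' hk'.ne']
    refine (Real.log_le_sub_one_of_pos (div_pos hlog hk')).trans ?_
    rw [sub_le_iff_le_add, div_add_one hk'.ne']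
    gcongr
    linarith

theorem Real.tendsto_sum_range_one_div_sub_log :
    Tendsto (fun k : ℕ => ∑ m ∈ Finset.range k, 1 / ((m : ℝ) + 1) - Real.log k) atTop
      (𝓝 Real.eulerMascheroniConstant) := by
  refine Real.tendsto_harmonic_sub_log.congr fun k => ?_
  rw [harmonic]
  push_cast
  simp only [one_div]

theorem Real.tendsto_log_one_sub_exp_neg_sub_log :
    Tendsto (fun s : ℝ => Real.log (1 - Real.exp (-(s - 1))) - Real.log (s - 1)) (𝓝[>] 1)
      (𝓝 0) := by
  have hd : HasDerivAt (fun s : ℝ => 1 - Real.exp (-(s - 1))) 1 1 := by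
    have := (((hasDerivAt_id (1 : ℝ)).sub_const 1).neg.exp).const_sub 1
    simpa using this
  have hslope := hd.tendsto_slope.mono_left (nhdsGT_le_nhdsNE 1)
  have hlog := hslope.log one_ne_zero
  rw [Real.log_one] at hlog
  refine hlog.congr' ?_
  filter_upwards [self_mem_nhdsWithin] with s hs
  have hs' : 0 < s - 1 := sub_pos.2 hs
  have h1 : 0 < 1 - Real.exp (-(s - 1)) := by
    rw [sub_pos, Real.exp_lt_one_iff]
    linarith
  rw [slope_def_field, ← Real.log_div h1.ne' hs'.ne']
  simp

/-- An Abelian theorem: the asymptotics of the sum of the reciprocals of the primes determine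
those of the prime zeta function at `1`. -/
theorem Nat.tendsto_tsum_prime_rpow_add_log_of_tendsto {M : ℝ}
    (hM : Tendsto (fun N : ℕ => ∑ p ∈ Finset.range N with p.Prime, 1 / (p : ℝ)
      - Real.log (Real.log N)) atTop (𝓝 M)) :
    Tendsto (fun s : ℝ => ∑' p : ℕ, (if p.Prime then (p : ℝ) ^ (-s) else 0) + Real.log (s - 1))
      (𝓝[>] 1) (𝓝 (M - Real.eulerMascheroniConstant)) := by
  let E : ℕ → ℕ := fun k => ⌈Real.exp k⌉₊
  have hE0 : E 0 = 1 := by simp [E]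
  have hEmono : Monotone E := fun i j hij =>
    Nat.ceil_mono (Real.exp_le_exp.2 (by exact_mod_cast hij))
  have hEtop : Tendsto E atTop atTop :=
    tendsto_nat_ceil_atTop.comp (Real.tendsto_exp_atTop.comp tendsto_natCast_atTop_atTop)
  let a : ℕ → ℝ := fun m => ∑ p ∈ Finset.Ico (E m) (E (m + 1)) with p.Prime, 1 / (p : ℝ)
  have hgroup (f : ℕ → ℝ) (k : ℕ) :
      ∑ m ∈ Finset.range k, ∑ p ∈ Finset.Ico (E m) (E (m + 1)) with p.Prime, f p
        = ∑ p ∈ Finset.range (E k) with p.Prime, f p := by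
    simp only [Finset.sum_filter]
    induction k with
    | zero => simp [hE0, Nat.not_prime_zero]
    | succ k ih => rw [Finset.sum_range_succ, ih, Finset.sum_range_add_sum_Ico _
        (hEmono (Nat.le_succ k))]
  let c : ℕ → ℝ := fun m => a m - 1 / ((m : ℝ) + 1)
  have hc : Tendsto (fun k => ∑ m ∈ Finset.range k, c m) atTop
      (𝓝 (M - Real.eulerMascheroniConstant)) := by
    have h := ((hM.comp hEtop).add Real.tendsto_log_log_natCeil_exp_sub_log).sub
      Real.tendsto_sum_range_one_div_sub_log
    rw [add_zero] at h
    refine h.congr fun k => ?_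
    simp only [c, a, E, Function.comp_apply]
    rw [Finset.sum_sub_distrib, hgroup]
    ring
  have habel := Real.tendsto_tsum_powerSeries_nhdsWithin_lt hc
  have hcs {z : ℝ} (hz0 : 0 ≤ z) (hz1 : z < 1) : Summable fun m => c m * z ^ m := by
    have h0 : Tendsto c atTop (𝓝 0) := by
      have := ((tendsto_add_atTop_iff_nat 1).2 hc).sub hc
      rw [sub_self] at this
      refine this.congr fun k => ?_
      rw [Finset.sum_range_succ]
      ring
    obtain ⟨K, hK⟩ := h0.norm.bddAbove_range
    refine Summable.of_norm_bounded (g := fun m => K * z ^ m)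
      ((summable_geometric_of_lt_one hz0 hz1).mul_left K) fun m => ?_
    rw [norm_mul, norm_pow, Real.norm_of_nonneg hz0]
    exact mul_le_mul_of_nonneg_right (hK ⟨m, rfl⟩) (by positivity)
  have hbounds {s : ℝ} (hs : 1 < s) :
      Real.exp (-(s - 1)) * (∑' m, c m * Real.exp (-(s - 1)) ^ m)
        ≤ ∑' p : ℕ, (if p.Prime then (p : ℝ) ^ (-s) else 0)
          + Real.log (1 - Real.exp (-(s - 1))) ∧
      ∑' p : ℕ, (if p.Prime then (p : ℝ) ^ (-s) else 0) + Real.log (1 - Real.exp (-(s - 1)))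
        ≤ ∑' m, c m * Real.exp (-(s - 1)) ^ m
          - (Real.exp (-(s - 1)))⁻¹ * (Real.log (1 - Real.exp (-(s - 1)))
            * (1 - Real.exp (-(s - 1)))) := by
    set z := Real.exp (-(s - 1)) with hz
    have hz0 : 0 < z := Real.exp_pos _
    have hz1 : z < 1 := Real.exp_lt_one_iff.2 (by linarith)
    have hgeo := Real.hasSum_pow_div_log_of_abs_lt_one (x := z) (by rwa [abs_of_pos hz0])
    have hgeo' : HasSum (fun m : ℕ => 1 / ((m : ℝ) + 1) * z ^ m) (z⁻¹ * -Real.log (1 - z)) := by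
      refine (hgeo.mul_left z⁻¹).congr_fun fun m => ?_
      rw [pow_succ]
      field_simp
    have hG : HasSum (fun m => a m * z ^ m)
        (∑' m, c m * z ^ m + z⁻¹ * -Real.log (1 - z)) := by
      refine ((hcs hz0.le hz1).hasSum.add hgeo').congr_fun fun m => ?_
      simp only [c]
      ring
    have hsump : Summable fun p : ℕ => if p.Prime then (p : ℝ) ^ (-s) else 0 :=
      Summable.of_nonneg_of_le (fun p => by positivity)
        (fun p => by split_ifs <;> [exact le_rfl; positivity])
        (Real.summable_nat_rpow.2 (by linarith : -s < -1))
    have hZ : Tendsto (fun k => ∑ m ∈ Finset.range k,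
        ∑ p ∈ Finset.Ico (E m) (E (m + 1)) with p.Prime, (p : ℝ) ^ (-s)) atTop
        (𝓝 (∑' p : ℕ, if p.Prime then (p : ℝ) ^ (-s) else 0)) := by
      refine (hsump.hasSum.tendsto_sum_nat.comp hEtop).congr fun k => ?_
      rw [Function.comp_apply, hgroup, Finset.sum_filter]
    have hterm (m p : ℕ) (hp : p ∈ Finset.Ico (E m) (E (m + 1))) (hpp : p.Prime) :
        1 / (p : ℝ) * (z * z ^ m) ≤ (p : ℝ) ^ (-s) ∧ (p : ℝ) ^ (-s) ≤ 1 / (p : ℝ) * z ^ m := by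
      have hp0 : (0 : ℝ) < p := by exact_mod_cast hpp.pos
      rw [Finset.mem_Ico] at hp
      have hlo : (m : ℝ) ≤ Real.log p := by
        rw [Real.le_log_iff_exp_le hp0]
        exact Nat.ceil_le.1 hp.1
      have hhi : Real.log p ≤ m + 1 := by
        rw [Real.log_le_iff_le_exp hp0]
        have := Nat.lt_ceil.1 hp.2
        push_cast at this
        exact this.le
      have hrw : (p : ℝ) ^ (-s) = 1 / (p : ℝ) * Real.exp (-(s - 1) * Real.log p) := by
        rw [show -s = -1 + -(s - 1) by ring, Real.rpow_add hp0, Real.rpow_neg_one, one_div,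
          Real.rpow_def_of_pos hp0 (-(s - 1)), mul_comm (Real.log p)]
      have hzm : z ^ m = Real.exp (-(s - 1) * m) := by
        rw [hz, ← Real.exp_nat_mul, mul_comm]
      rw [hrw, hzm, hz, ← Real.exp_add]
      constructor
      · gcongr
        nlinarith
      · gcongr ?_ * ?_
        rw [Real.exp_le_exp]
        nlinarith
    constructor
    · have h1 : z * (∑' m, c m * z ^ m + z⁻¹ * -Real.log (1 - z))
          ≤ ∑' p : ℕ, if p.Prime then (p : ℝ) ^ (-s) else 0 := by
        refine le_of_tendsto_of_tendsto' (hG.mul_left z).tendsto_sum_nat hZ fun k => ?_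
        refine Finset.sum_le_sum fun m _ => ?_
        simp only [a]
        rw [mul_left_comm, Finset.sum_mul]
        refine Finset.sum_le_sum fun p hp => ?_
        rw [Finset.mem_filter] at hp
        exact (hterm m p hp.1 hp.2).1
      rw [mul_add, mul_inv_cancel_left₀ hz0.ne'] at h1
      linarith
    · have h1 : ∑' p : ℕ, (if p.Prime then (p : ℝ) ^ (-s) else 0)
          ≤ ∑' m, c m * z ^ m + z⁻¹ * -Real.log (1 - z) := by
        refine le_of_tendsto_of_tendsto' hZ hG.tendsto_sum_nat fun k => ?_
        refine Finset.sum_le_sum fun m _ => ?_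
        simp only [a]
        rw [Finset.sum_mul]
        refine Finset.sum_le_sum fun p hp => ?_
        rw [Finset.mem_filter] at hp
        exact (hterm m p hp.1 hp.2).2
      have h2 : z⁻¹ * (Real.log (1 - z) * (1 - z))
          = z⁻¹ * Real.log (1 - z) - Real.log (1 - z) := by
        field_simp
      rw [h2]
      linarith
  have hzlim : Tendsto (fun s : ℝ => Real.exp (-(s - 1))) (𝓝[>] 1) (𝓝[<] 1) := by
    refine tendsto_nhdsWithin_iff.2 ⟨?_, ?_⟩
    · have h : Continuous fun s : ℝ => Real.exp (-(s - 1)) := by fun_prop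
      have h1 := h.tendsto 1
      simp only [sub_self, neg_zero, Real.exp_zero] at h1
      exact h1.mono_left nhdsWithin_le_nhds
    · filter_upwards [self_mem_nhdsWithin] with s hs
      have hs' : 1 < s := hs
      exact Real.exp_lt_one_iff.2 (by linarith)
  have hz1 : Tendsto (fun s : ℝ => Real.exp (-(s - 1))) (𝓝[>] 1) (𝓝 1) :=
    hzlim.mono_right nhdsWithin_le_nhds
  have hC := habel.comp hzlim
  have herr : Tendsto (fun s : ℝ => (Real.exp (-(s - 1)))⁻¹ *
      (Real.log (1 - Real.exp (-(s - 1))) * (1 - Real.exp (-(s - 1))))) (𝓝[>] 1) (𝓝 0) := by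
    have h1 : Tendsto (fun s : ℝ => 1 - Real.exp (-(s - 1))) (𝓝[>] 1) (𝓝 0) := by
      simpa using hz1.const_sub 1
    have h2 := (Real.continuous_mul_log.tendsto 0).comp h1
    have h3 := (hz1.inv₀ one_ne_zero).mul h2
    simp only [zero_mul, mul_zero] at h3
    refine h3.congr fun s => ?_
    simp only [Function.comp_apply]
    ring
  have hmain : Tendsto (fun s : ℝ => ∑' p : ℕ, (if p.Prime then (p : ℝ) ^ (-s) else 0)
      + Real.log (1 - Real.exp (-(s - 1)))) (𝓝[>] 1)
      (𝓝 (M - Real.eulerMascheroniConstant)) := by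
    have hlo := hz1.mul hC
    have hhi := hC.sub herr
    rw [one_mul] at hlo
    rw [sub_zero] at hhi
    refine tendsto_of_tendsto_of_tendsto_of_le_of_le' hlo hhi ?_ ?_
    · filter_upwards [self_mem_nhdsWithin] with s hs using (hbounds hs).1
    · filter_upwards [self_mem_nhdsWithin] with s hs using (hbounds hs).2
  have hfin := hmain.sub Real.tendsto_log_one_sub_exp_neg_sub_log
  rw [sub_zero] at hfin
  refine hfin.congr fun s => ?_
  ring

/-- **Mertens' third theorem**, in logarithmic form. -/
theorem Nat.tendsto_sum_log_one_sub_one_div_prime_add_log_log :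
    Tendsto (fun N : ℕ => ∑ p ∈ Finset.range N with p.Prime, Real.log (1 - 1 / (p : ℝ))
      + Real.log (Real.log N)) atTop (𝓝 (-Real.eulerMascheroniConstant)) := by
  obtain ⟨M, hM⟩ := Nat.exists_tendsto_sum_one_div_prime_sub_log_log
  have huniq := tendsto_nhds_unique Nat.tendsto_tsum_prime_rpow_add_log
    (Nat.tendsto_tsum_prime_rpow_add_log_of_tendsto hM)
  have hs := (Nat.summable_ite_prime_mul_log_one_sub_add (w := fun _ => 1) (K := 1)
    (by simp)).hasSum.tendsto_sum_nat
  simp only [one_mul] at hs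
  rw [huniq] at hs
  have h := hs.sub hM
  rw [show M - Real.eulerMascheroniConstant - M = -Real.eulerMascheroniConstant by ring] at h
  refine h.congr fun N => ?_
  rw [← Finset.sum_filter, Finset.sum_add_distrib]
  ring

/-- The sum of `log p` over the primes `p < N` in a reduced residue class grows linearly. -/
theorem Nat.exists_mul_le_sum_log_prime_modEq {q a : ℕ} (hq : 0 < q) (hqa : q.Coprime a) :
    ∃ c : ℝ, 0 < c ∧ ∀ᶠ N : ℕ in atTop,
      c * N ≤ ∑ p ∈ Finset.range N with p.Prime ∧ p ≡ a [MOD q], Real.log p := by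
  obtain ⟨B, hB⟩ := Nat.exists_abs_sum_log_prime_modEq_div_sub_log_le hq hqa
  have hφ : (0 : ℝ) < q.totient := by exact_mod_cast Nat.totient_pos.2 hq
  obtain ⟨K, hK, hK1⟩ : ∃ K : ℕ, q.totient * (2 * B + 1) ≤ Real.log K ∧ 1 ≤ K :=
    (((Real.tendsto_log_atTop.comp tendsto_natCast_atTop_atTop).eventually_ge_atTop _).and
      (eventually_ge_atTop 1)).exists
  have hK' : (0 : ℝ) < K := by exact_mod_cast hK1
  refine ⟨1 / (2 * K), by positivity, ?_⟩
  filter_upwards [eventually_ge_atTop K] with N hN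
  have hN0 : (0 : ℝ) < N := by exact_mod_cast hK1.trans hN
  set y := N / K with hy
  have hy1 : 1 ≤ y := (Nat.one_le_div_iff hK1).2 hN
  have hy0 : (0 : ℝ) < y := by exact_mod_cast hy1
  have hyN : y ≤ N := Nat.div_le_self N K
  have hlog : Real.log K + Real.log y ≤ Real.log N := by
    rw [← Real.log_mul hK'.ne' hy0.ne']
    exact Real.log_le_log (by positivity) (by exact_mod_cast Nat.mul_div_le N K)
  have hlog' : 2 * B + 1 ≤ Real.log N / q.totient - Real.log y / q.totient := by
    rw [← sub_div, le_div_iff₀ hφ]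
    linarith
  have h1 := (abs_le.1 (hB N)).1
  have h2 := (abs_le.1 (hB y)).2
  have h3 : ∑ p ∈ Finset.range N with p.Prime ∧ p ≡ a [MOD q], Real.log p / p
      ≤ ∑ p ∈ Finset.range y with p.Prime ∧ p ≡ a [MOD q], Real.log p / p
        + (∑ p ∈ Finset.range N with p.Prime ∧ p ≡ a [MOD q], Real.log p) / y := by
    simp only [Finset.sum_filter]
    rw [← Finset.sum_range_add_sum_Ico _ hyN, ← Finset.sum_range_add_sum_Ico (fun p =>
      if p.Prime ∧ p ≡ a [MOD q] then Real.log p else 0) hyN, add_div]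
    have h4 : 0 ≤ (∑ p ∈ Finset.range y, if p.Prime ∧ p ≡ a [MOD q] then Real.log p else 0) / y :=
      div_nonneg (Finset.sum_nonneg fun p _ => by
        split_ifs
        exacts [Real.log_natCast_nonneg p, le_rfl]) hy0.le
    have h5 : ∑ p ∈ Finset.Ico y N, (if p.Prime ∧ p ≡ a [MOD q] then Real.log p / p else 0)
        ≤ (∑ p ∈ Finset.Ico y N, if p.Prime ∧ p ≡ a [MOD q] then Real.log p else 0) / y := by
      rw [Finset.sum_div]
      refine Finset.sum_le_sum fun p hp => ?_
      split_ifs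
      · have hyp : (y : ℝ) ≤ p := by exact_mod_cast (Finset.mem_Ico.1 hp).1
        exact div_le_div_of_nonneg_left (Real.log_natCast_nonneg p) hy0 hyp
      · simp
    linarith
  have h6 : 1 ≤ (∑ p ∈ Finset.range N with p.Prime ∧ p ≡ a [MOD q], Real.log p) / y := by
    linarith
  rw [le_div_iff₀ hy0, one_mul] at h6
  refine le_trans ?_ h6
  rw [one_div, inv_mul_le_iff₀ (by positivity)]
  have h7 : N ≤ 2 * K * y := by
    have := Nat.lt_div_mul_add hK1 (a := N)
    nlinarith
  exact_mod_cast h7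

theorem Nat.sum_log_prime_modEq_le (q a N : ℕ) :
    ∑ p ∈ Finset.range N with p.Prime ∧ p ≡ a [MOD q], Real.log p ≤ Real.log 4 * N := by
  refine le_trans ?_ (Chebyshev.theta_le_log4_mul_x (x := N) N.cast_nonneg)
  rw [Chebyshev.theta, Nat.floor_natCast]
  refine Finset.sum_le_sum_of_subset_of_nonneg (fun p hp => ?_)
    fun p _ _ => Real.log_natCast_nonneg p
  rw [Finset.mem_filter, Finset.mem_range] at hp
  rw [Finset.mem_filter, Finset.mem_Ioc]
  exact ⟨⟨hp.2.1.pos, hp.1.le⟩, hp.2.1⟩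

theorem Real.tendsto_log_log_sub_log_log_of_linear {u : ℕ → ℝ} {c d : ℝ} (hc : 0 < c)
    (hlo : ∀ᶠ N : ℕ in atTop, c * N ≤ u N) (hhi : ∀ᶠ N : ℕ in atTop, u N ≤ d * N) :
    Tendsto (fun N : ℕ => Real.log (Real.log (u N)) - Real.log (Real.log N)) atTop (𝓝 0) := by
  have hlogtop : Tendsto (fun N : ℕ => Real.log N) atTop atTop :=
    Real.tendsto_log_atTop.comp tendsto_natCast_atTop_atTop
  have haux (e : ℝ) : Tendsto (fun N : ℕ => 1 + Real.log e / Real.log N) atTop (𝓝 1) := by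
    simpa using (hlogtop.const_div_atTop (Real.log e)).const_add 1
  have hquot : Tendsto (fun N : ℕ => Real.log (u N) / Real.log N) atTop (𝓝 1) := by
    refine tendsto_of_tendsto_of_tendsto_of_le_of_le' (haux c) (haux d) ?_ ?_
    all_goals
      filter_upwards [hlo, hhi, hlogtop.eventually_gt_atTop 0, eventually_gt_atTop 0]
        with N h1 h2 h3 h4
      have hN : (0 : ℝ) < N := by exact_mod_cast h4
      have hcN : 0 < c * N := by positivity
      have hu : 0 < u N := hcN.trans_le h1
      have hd : 0 < d := pos_of_mul_pos_left (hu.trans_le h2) hN.le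
      rw [one_add_div h3.ne', add_comm]
      refine div_le_div_of_nonneg_right ?_ h3.le
    · rw [← Real.log_mul hc.ne' hN.ne']
      exact Real.log_le_log hcN h1
    · rw [← Real.log_mul hd.ne' hN.ne']
      exact Real.log_le_log hu h2
  have hlog := hquot.log one_ne_zero
  rw [Real.log_one] at hlog
  refine hlog.congr' ?_
  filter_upwards [hlogtop.eventually_gt_atTop 0, hquot.eventually (lt_mem_nhds one_pos)]
    with N h1 h2
  have h3 : 0 < Real.log (u N) := by
    have := mul_pos h2 h1
    rwa [div_mul_cancel₀ _ h1.ne'] at this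
  rw [Real.log_div h3.ne' h1.ne']

theorem Nat.div_totient_eq_exp {n : ℕ} (hn : 0 < n) :
    (n : ℝ) / n.totient
      = Real.exp (∑ p ∈ n.primeFactors, -Real.log (1 - 1 / (p : ℝ))) := by
  have h : (n.totient : ℝ) = n * ∏ p ∈ n.primeFactors, (1 - (p : ℝ)⁻¹) := by
    have := congrArg (fun x : ℚ => (x : ℝ)) (Nat.totient_eq_mul_prod_factors n)
    push_cast at this
    exact this
  have hn' : (n : ℝ) ≠ 0 := by exact_mod_cast hn.ne'
  have hprod : ∏ p ∈ n.primeFactors, (1 - (p : ℝ)⁻¹)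
      = Real.exp (∑ p ∈ n.primeFactors, Real.log (1 - 1 / (p : ℝ))) := by
    rw [Real.exp_sum]
    refine Finset.prod_congr rfl fun p hp => ?_
    rw [Real.exp_log (Nat.prime_of_mem_primeFactors hp).one_sub_one_div_pos, one_div]
  rw [h, hprod, Finset.sum_neg_distrib, Real.exp_neg]
  field_simp

theorem Nat.nth_le_orderEmbOfFin {P : ℕ → Prop} {s : Finset ℕ} (hs : ∀ n ∈ s, P n) {k : ℕ}
    (hk : s.card = k) (i : Fin k) : Nat.nth P i ≤ s.orderEmbOfFin hk i := by
  classical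
  have hmem : P (s.orderEmbOfFin hk i) := hs _ (s.orderEmbOfFin_mem hk i)
  by_cases hcount : (i : ℕ) ≤ Nat.count P (s.orderEmbOfFin hk i)
  · have h := Nat.nth_count hmem
    rcases hcount.eq_or_lt with he | hlt
    · rw [he, h]
    · exact (Nat.nth_lt_of_lt_count hlt).le
  · refine absurd ?_ hcount
    rw [Nat.count_eq_card_filter_range]
    calc (i : ℕ) = ((Finset.Iio i).map (s.orderEmbOfFin hk).toEmbedding).card := by simp
      _ ≤ _ := by
        refine Finset.card_le_card fun x hx => ?_
        obtain ⟨j, hj, rfl⟩ := Finset.mem_map.1 hx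
        rw [Finset.mem_filter, Finset.mem_range]
        exact ⟨(s.orderEmbOfFin hk).lt_iff_lt.2 (Finset.mem_Iio.1 hj),
          hs _ (s.orderEmbOfFin_mem hk j)⟩

@[to_additive]
theorem Nat.prod_range_nth_eq {P : ℕ → Prop} [DecidablePred P] (hP : (Set.ofPred P).Infinite)
    {M : Type*} [CommMonoid M] (f : ℕ → M) (k : ℕ) :
    ∏ i ∈ Finset.range k, f (Nat.nth P i) = ∏ p ∈ Finset.range (Nat.nth P k) with P p, f p := by
  induction k with
  | zero =>
    have h := Nat.count_nth_of_infinite hP 0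
    rw [Nat.count_eq_card_filter_range, Finset.card_eq_zero] at h
    rw [h]
    simp
  | succ k ih =>
    rw [Nat.filter_range_nth_eq_insert_of_infinite hP, Finset.prod_insert (by simp),
      Finset.prod_range_succ, ih, mul_comm]

@[to_additive]
theorem Finset.prod_eq_prod_orderEmbOfFin {M : Type*} [CommMonoid M] (s : Finset ℕ) {k : ℕ}
    (hk : s.card = k) (f : ℕ → M) : ∏ p ∈ s, f p = ∏ i : Fin k, f (s.orderEmbOfFin hk i) := by
  conv_lhs => rw [← s.map_orderEmbOfFin_univ hk, Finset.prod_map]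
  rfl

namespace PrimesAP

variable {q a : ℕ}

theorem C_eq_exp {l : ℝ} (hl : Tendsto (fun N => ∑ p ∈ Finset.range N with p.Prime,
      (alpha q a p : ℝ) * Real.log (1 - 1 / (p : ℝ))) atTop (𝓝 l)) :
    Tendsto (partialProd q a) atTop (𝓝 (Real.exp l)) ∧
      C q a = Real.exp ((l - Real.eulerMascheroniConstant) / q.totient) := by
  have h : Tendsto (partialProd q a) atTop (𝓝 (Real.exp l)) :=
    ((Real.continuous_exp.tendsto l).comp ((tendsto_add_atTop_iff_nat 1).2 hl)).congr
      fun x => (partialProd_eq_exp q a x).symm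
  refine ⟨h, ?_⟩
  rw [C, h.limUnder_eq, ← Real.exp_add, ← Real.exp_mul]
  congr 1
  ring

theorem C_pos (hq : 0 < q) (hqa : q.Coprime a) : 0 < C q a := by
  obtain ⟨l, hl⟩ := exists_tendsto_sum_alpha_mul_log hq hqa
  rw [(C_eq_exp hl).2]
  exact Real.exp_pos _

theorem tendsto_exp_mul_partialProd (hq : 0 < q) (hqa : q.Coprime a) :
    Tendsto (fun x : ℕ => Real.exp (-Real.eulerMascheroniConstant) * partialProd q a x)
      atTop (𝓝 (C q a ^ q.totient)) := by
  obtain ⟨l, hl⟩ := exists_tendsto_sum_alpha_mul_log hq hqa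
  have hφ : (q.totient : ℝ) ≠ 0 := by exact_mod_cast (Nat.totient_pos.2 hq).ne'
  obtain ⟨h1, h2⟩ := C_eq_exp hl
  rw [h2, ← Real.exp_nat_mul, mul_div_cancel₀ _ hφ, sub_eq_add_neg, add_comm, Real.exp_add]
  exact h1.const_mul _

theorem C_one : C 1 a = Real.exp (-Real.eulerMascheroniConstant) := by
  have h0 (p : ℕ) : alpha 1 a p = 0 := by simp [alpha, Nat.modEq_one]
  have hl : Tendsto (fun N => ∑ p ∈ Finset.range N with p.Prime,
      (alpha 1 a p : ℝ) * Real.log (1 - 1 / (p : ℝ))) atTop (𝓝 0) := by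
    simp [h0]
  rw [(C_eq_exp hl).2]
  simp

/-- **Mertens' third theorem** in arithmetic progressions, in logarithmic form. -/
theorem tendsto_sum_log_one_sub_add_log_log (hq : 0 < q) (hqa : q.Coprime a) :
    Tendsto (fun N : ℕ => ∑ p ∈ Finset.range N with p.Prime ∧ p ≡ a [MOD q],
      Real.log (1 - 1 / (p : ℝ)) + 1 / q.totient * Real.log (Real.log N)) atTop
      (𝓝 (Real.log (C q a))) := by
  obtain ⟨l, hl⟩ := exists_tendsto_sum_alpha_mul_log hq hqa
  have hφ : (q.totient : ℝ) ≠ 0 := by exact_mod_cast (Nat.totient_pos.2 hq).ne'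
  rw [(C_eq_exp hl).2, Real.log_exp]
  have h := (hl.add Nat.tendsto_sum_log_one_sub_one_div_prime_add_log_log).div_const
    (q.totient : ℝ)
  rw [← sub_eq_add_neg] at h
  refine h.congr fun N => ?_
  rw [sum_alpha_mul]
  field_simp
  ring

theorem infinite_primes (hq : 0 < q) (hqa : q.Coprime a) :
    (Set.ofPred fun p : ℕ => p.Prime ∧ p ≡ a [MOD q]).Infinite :=
  Nat.infinite_setOfPred_prime_and_modEq hq.ne' hqa.symm

theorem nthPrime_spec (hq : 0 < q) (hqa : q.Coprime a) (i : ℕ) :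
    (nthPrime q a i).Prime ∧ nthPrime q a i ≡ a [MOD q] :=
  Nat.nth_mem_of_infinite (infinite_primes hq hqa) i

theorem tendsto_nthPrime (hq : 0 < q) (hqa : q.Coprime a) :
    Tendsto (nthPrime q a) atTop atTop :=
  (Nat.nth_strictMono (infinite_primes hq hqa)).tendsto_atTop

theorem primorial_eq_prod (hq : 0 < q) (hqa : q.Coprime a) (k : ℕ) :
    primorial q a k
      = ∏ p ∈ Finset.range (nthPrime q a k) with p.Prime ∧ p ≡ a [MOD q], p :=
  Nat.prod_range_nth_eq (infinite_primes hq hqa) (fun p => p) k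

theorem primeFactors_primorial (hq : 0 < q) (hqa : q.Coprime a) (k : ℕ) :
    (primorial q a k).primeFactors
      = (Finset.range (nthPrime q a k)).filter fun p => p.Prime ∧ p ≡ a [MOD q] := by
  rw [primorial_eq_prod hq hqa]
  exact Nat.primeFactors_prod fun p hp => (Finset.mem_filter.1 hp).2.1

theorem primorial_mem_S (hq : 0 < q) (hqa : q.Coprime a) (k : ℕ) : primorial q a k ∈ S q a := by
  have h0 : primorial q a k ≠ 0 :=
    Finset.prod_ne_zero_iff.2 fun i _ => (nthPrime_spec hq hqa i).1.ne_zero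
  refine ⟨Nat.pos_of_ne_zero h0, fun p hp hdvd => ?_⟩
  have hmem := Nat.mem_primeFactors.2 ⟨hp, hdvd, h0⟩
  rw [primeFactors_primorial hq hqa] at hmem
  exact (Finset.mem_filter.1 hmem).2.2

theorem tendsto_primorial_atTop (hq : 0 < q) (hqa : q.Coprime a) :
    Tendsto (primorial q a) atTop atTop := by
  refine tendsto_atTop_mono (fun k => ?_) tendsto_id
  induction k with
  | zero => exact Nat.zero_le _
  | succ k ih =>
    have h1 := (primorial_mem_S hq hqa k).1
    have h2 := (nthPrime_spec hq hqa k).1.two_le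
    have h3 : primorial q a (k + 1) = primorial q a k * nthPrime q a k :=
      Finset.prod_range_succ _ _
    simp only [id_eq] at ih ⊢
    rw [h3]
    nlinarith

theorem tendsto_primorial (hq : 0 < q) (hqa : q.Coprime a) :
    Tendsto (primorial q a) atTop (atTop ⊓ 𝓟 (S q a)) :=
  tendsto_inf.2 ⟨tendsto_primorial_atTop hq hqa,
    tendsto_principal.2 (Eventually.of_forall (primorial_mem_S hq hqa))⟩

theorem ratio_eq {n : ℕ} (hn : 0 < n) :
    ratio q n = Real.exp (∑ p ∈ n.primeFactors, -Real.log (1 - 1 / (p : ℝ)))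
      / Real.log (q.totient * Real.log n) ^ (1 / (q.totient : ℝ)) := by
  rw [ratio, div_mul_eq_div_div, Nat.div_totient_eq_exp hn]

theorem tendsto_log_totient_mul_log (hq : 0 < q) :
    Tendsto (fun n : ℕ => Real.log (q.totient * Real.log n)) atTop atTop := by
  have hφ : (0 : ℝ) < q.totient := by exact_mod_cast Nat.totient_pos.2 hq
  exact Real.tendsto_log_atTop.comp
    ((Real.tendsto_log_atTop.comp tendsto_natCast_atTop_atTop).const_mul_atTop hφ)

theorem tendsto_ratio_primorial (hq : 0 < q) (hqa : q.Coprime a) :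
    Tendsto (fun k : ℕ => ratio q (primorial q a k)) atTop (𝓝 (1 / C q a)) := by
  have hφ : (0 : ℝ) < q.totient := by exact_mod_cast Nat.totient_pos.2 hq
  obtain ⟨c, hc, hlo⟩ := Nat.exists_mul_le_sum_log_prime_modEq hq hqa
  have hloglog := Real.tendsto_log_log_sub_log_log_of_linear
    (u := fun N => q.totient * ∑ p ∈ Finset.range N with p.Prime ∧ p ≡ a [MOD q], Real.log p)
    (c := q.totient * c) (d := q.totient * Real.log 4) (by positivity)
    (hlo.mono fun N h => by
      rw [mul_assoc]
      exact mul_le_mul_of_nonneg_left h hφ.le)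
    (Eventually.of_forall fun N => by
      rw [mul_assoc]
      exact mul_le_mul_of_nonneg_left (Nat.sum_log_prime_modEq_le q a N) hφ.le)
  have hsum := ((tendsto_sum_log_one_sub_add_log_log hq hqa).add
    (hloglog.const_mul (1 / (q.totient : ℝ)))).neg
  rw [mul_zero, add_zero] at hsum
  have hexp := (Real.continuous_exp.tendsto _).comp (hsum.comp (tendsto_nthPrime hq hqa))
  rw [Real.exp_neg, Real.exp_log (C_pos hq hqa), ← one_div] at hexp
  refine hexp.congr' ?_
  filter_upwards [((tendsto_log_totient_mul_log hq).comp
    (tendsto_primorial_atTop hq hqa)).eventually_gt_atTop 0] with k hk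
  have hlog : Real.log (primorial q a k)
      = ∑ p ∈ Finset.range (nthPrime q a k) with p.Prime ∧ p ≡ a [MOD q], Real.log p := by
    rw [primorial_eq_prod hq hqa, Nat.cast_prod, Real.log_prod]
    intro p hp
    exact_mod_cast (Finset.mem_filter.1 hp).2.1.ne_zero
  simp only [Function.comp_apply] at hk ⊢
  rw [ratio_eq (primorial_mem_S hq hqa k).1, primeFactors_primorial hq hqa,
    Real.rpow_def_of_pos hk, ← Real.exp_sub, hlog, Finset.sum_neg_distrib]
  congr 1
  ring

theorem neg_log_one_sub_one_div_le {m n : ℕ} (hm : 2 ≤ m) (hmn : m ≤ n) :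
    -Real.log (1 - 1 / (n : ℝ)) ≤ -Real.log (1 - 1 / (m : ℝ)) := by
  have hm' : (2 : ℝ) ≤ m := by exact_mod_cast hm
  have hmn' : (m : ℝ) ≤ n := by exact_mod_cast hmn
  have h1 : 1 / (m : ℝ) ≤ 1 / 2 := one_div_le_one_div_of_le (by norm_num) hm'
  have h2 : 1 / (n : ℝ) ≤ 1 / m := one_div_le_one_div_of_le (by linarith) hmn'
  exact neg_le_neg (Real.log_le_log (by linarith) (by linarith))

theorem neg_log_one_sub_one_div_nonneg {p : ℕ} (hp : p.Prime) :
    0 ≤ -Real.log (1 - 1 / (p : ℝ)) := by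
  have h : 0 ≤ 1 / (p : ℝ) := by positivity
  exact neg_nonneg.2 (Real.log_nonpos hp.one_sub_one_div_pos.le (by linarith))

theorem sum_primeFactors_le (hq : 0 < q) (hqa : q.Coprime a) {n : ℕ} (hn : n ∈ S q a) :
    ∑ p ∈ n.primeFactors, -Real.log (1 - 1 / (p : ℝ))
      ≤ ∑ i ∈ Finset.range n.primeFactors.card, -Real.log (1 - 1 / (nthPrime q a i : ℝ)) := by
  rw [Finset.sum_eq_sum_orderEmbOfFin _ rfl, Finset.sum_range]
  refine Finset.sum_le_sum fun i _ => neg_log_one_sub_one_div_le (nthPrime_spec hq hqa i).1.two_le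
    (Nat.nth_le_orderEmbOfFin (fun p hp => ?_) rfl i)
  exact ⟨Nat.prime_of_mem_primeFactors hp,
    hn.2 p (Nat.prime_of_mem_primeFactors hp) (Nat.dvd_of_mem_primeFactors hp)⟩

theorem primorial_card_primeFactors_le {n : ℕ} (hn : n ∈ S q a) :
    primorial q a n.primeFactors.card ≤ n := by
  refine le_trans ?_ (Nat.le_of_dvd hn.1 n.prod_primeFactors_dvd)
  rw [Finset.prod_eq_prod_orderEmbOfFin _ rfl, primorial, Finset.prod_range]
  refine Finset.prod_le_prod' fun i _ => Nat.nth_le_orderEmbOfFin (fun p hp => ?_) rfl i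
  exact ⟨Nat.prime_of_mem_primeFactors hp,
    hn.2 p (Nat.prime_of_mem_primeFactors hp) (Nat.dvd_of_mem_primeFactors hp)⟩

theorem sum_primeFactors_primorial (hq : 0 < q) (hqa : q.Coprime a) (k : ℕ) (f : ℕ → ℝ) :
    ∑ p ∈ (primorial q a k).primeFactors, f p = ∑ i ∈ Finset.range k, f (nthPrime q a i) := by
  rw [primeFactors_primorial hq hqa]
  exact (Nat.sum_range_nth_eq (infinite_primes hq hqa) f k).symm

theorem ratio_le_ratio_primorial (hq : 0 < q) (hqa : q.Coprime a) {n : ℕ} (hn : n ∈ S q a)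
    (hpos : 0 < Real.log (q.totient * Real.log (primorial q a n.primeFactors.card))) :
    ratio q n ≤ ratio q (primorial q a n.primeFactors.card) := by
  have hφ : (0 : ℝ) < q.totient := by exact_mod_cast Nat.totient_pos.2 hq
  have hmem := primorial_mem_S hq hqa n.primeFactors.card
  rw [ratio_eq hn.1, ratio_eq hmem.1, sum_primeFactors_primorial hq hqa]
  have hne : (q.totient : ℝ) * Real.log (primorial q a n.primeFactors.card) ≠ 0 := by
    intro h
    rw [h, Real.log_zero] at hpos
    exact lt_irrefl _ hpos
  have hle : Real.log (primorial q a n.primeFactors.card) ≤ Real.log n :=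
    Real.log_le_log (by exact_mod_cast hmem.1) (by exact_mod_cast primorial_card_primeFactors_le hn)
  have hbase : 0 < (q.totient : ℝ) * Real.log (primorial q a n.primeFactors.card) :=
    lt_of_le_of_ne (mul_nonneg hφ.le (Real.log_natCast_nonneg _)) hne.symm
  have hloglog : Real.log (q.totient * Real.log (primorial q a n.primeFactors.card))
      ≤ Real.log (q.totient * Real.log n) :=
    Real.log_le_log hbase (mul_le_mul_of_nonneg_left hle hφ.le)
  refine div_le_div₀ (Real.exp_pos _).le (Real.exp_le_exp.2 (sum_primeFactors_le hq hqa hn))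
    (Real.rpow_pos_of_pos hpos _) (Real.rpow_le_rpow hpos.le hloglog (by positivity))

theorem eventually_ratio_le (hq : 0 < q) (hqa : q.Coprime a) {r : ℝ} (hr : 1 / C q a < r) :
    ∀ᶠ n in atTop ⊓ 𝓟 (S q a), ratio q n ≤ r := by
  have hφ : (0 : ℝ) < q.totient := by exact_mod_cast Nat.totient_pos.2 hq
  have hr0 : 0 < r := (one_div_pos.2 (C_pos hq hqa)).trans hr
  obtain ⟨K, hK⟩ := eventually_atTop.1
    (((tendsto_ratio_primorial hq hqa).eventually (ge_mem_nhds hr)).and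
      (((tendsto_log_totient_mul_log hq).comp
        (tendsto_primorial_atTop hq hqa)).eventually_gt_atTop 0))
  let A : ℝ := Real.exp (∑ i ∈ Finset.range K, -Real.log (1 - 1 / (nthPrime q a i : ℝ)))
  have hsmall : Tendsto (fun n : ℕ => A / Real.log (q.totient * Real.log n) ^
      (1 / (q.totient : ℝ))) atTop (𝓝 0) :=
    ((tendsto_rpow_atTop (by positivity)).comp
      (tendsto_log_totient_mul_log hq)).const_div_atTop A
  rw [eventually_inf_principal]
  filter_upwards [hsmall.eventually (ge_mem_nhds hr0),
    (tendsto_log_totient_mul_log hq).eventually_gt_atTop 0] with n h1 h2 hn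
  rcases le_or_gt K n.primeFactors.card with h | h
  · exact (ratio_le_ratio_primorial hq hqa hn (hK _ h).2).trans (hK _ h).1
  · refine le_trans ?_ h1
    rw [ratio_eq hn.1]
    refine div_le_div_of_nonneg_right (Real.exp_le_exp.2 ?_) (Real.rpow_pos_of_pos h2 _).le
    refine (sum_primeFactors_le hq hqa hn).trans ?_
    exact Finset.sum_le_sum_of_subset_of_nonneg (Finset.range_mono h.le)
      fun i _ _ => neg_log_one_sub_one_div_nonneg (nthPrime_spec hq hqa i).1

theorem limsup_ratio (hq : 0 < q) (hqa : q.Coprime a) :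
    limsup (fun n : ℕ => ((ratio q n : ℝ) : EReal)) (atTop ⊓ 𝓟 (S q a))
      = ((1 / C q a : ℝ) : EReal) := by
  refine le_antisymm ?_ ?_
  · refine EReal.le_of_forall_lt_iff_le.1 ?_
    intro r hr
    refine limsup_le_of_le (by isBoundedDefault) ?_
    filter_upwards [eventually_ratio_le hq hqa (EReal.coe_lt_coe_iff.1 hr)] with n hn
    exact EReal.coe_le_coe_iff.2 hn
  · have h : Tendsto (fun k : ℕ => ((ratio q (primorial q a k) : ℝ) : EReal)) atTop
        (𝓝 ((1 / C q a : ℝ) : EReal)) :=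
      (continuous_coe_real_ereal.tendsto _).comp (tendsto_ratio_primorial hq hqa)
    rw [← h.limsup_eq]
    exact limsup_le_limsup_of_le (u := fun n : ℕ => ((ratio q n : ℝ) : EReal))
      (tendsto_primorial hq hqa)

end PrimesAP

theorem mainTheorem7 (q a : ℕ) (hq : 0 < q) (hqa : Nat.Coprime q a) :
    0 < PrimesAP.C q a ∧
    Tendsto (fun x : ℕ => Real.exp (-Real.eulerMascheroniConstant) * PrimesAP.partialProd q a x)
      atTop (𝓝 (PrimesAP.C q a ^ q.totient)) ∧
    (q = 1 → PrimesAP.C q a = Real.exp (-Real.eulerMascheroniConstant)) ∧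
    limsup (fun n : ℕ => ((PrimesAP.ratio q n : ℝ) : EReal)) (atTop ⊓ 𝓟 (PrimesAP.S q a)) =
      ((1 / PrimesAP.C q a : ℝ) : EReal) ∧
    Tendsto (PrimesAP.primorial q a) atTop (atTop ⊓ 𝓟 (PrimesAP.S q a)) ∧
    Tendsto (fun k : ℕ => PrimesAP.ratio q (PrimesAP.primorial q a k)) atTop
      (𝓝 (1 / PrimesAP.C q a)) :=
  ⟨PrimesAP.C_pos hq hqa, PrimesAP.tendsto_exp_mul_partialProd hq hqa,
    fun h => h ▸ PrimesAP.C_one, PrimesAP.limsup_ratio hq hqa,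
    PrimesAP.tendsto_primorial hq hqa, PrimesAP.tendsto_ratio_primorial hq hqa⟩
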